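/- Let $K$ be a field of characteristic zero. All operads are symmetric operads over $K$. For a finite-dimensional $S_2$-module $E$, let $F(E)$ be the free operad on $E$ placed in arity $2$; for an $S_3$-submodule $R\subseteq F(E)(3)$ let $P(E,R)=F(E)/(R)$. Write $E^\vee=E^*\otimes\mathrm{sgn}$. The space $F(E)(3)$ is the direct sum of three copies of $E\otimes E$, indexed by $c$, where $\mu\otimes\nu$ in the copy $c$ stands for the composition $\mu(\nu(x_a,x_b),x_c)$ with $(a,b,c)$ a cyclic permutation of $(1,2,3)$; let $\langle-,-\rangle:F(E^\vee)(3)\otimes F(E)(3)\to K$ be the scalar product that pairs $\alpha\otimes\beta$ in the copy $c$ with $\mu\otimes\nu$ in the copy $c'$ to $\alpha(\mu)\beta(\nu)$ if $c=c'$ and to $0$ otherwise. The Koszul dual operad of $P(E,R)$ is $P(E,R)^!=P(E^\vee,R^\perp)$. Let $\mathbf{sDiAss}$ be the operad of symmetric dialgebras: it is generated by two binary operations $\vdash,\dashv$ without symmetry, with the relations $(a\circ_1 b)\circ_2 c=a\circ_3(b\circ_4 c)$ for all $\circ_1,\circ_2,\circ_3,\circ_4\in\{\vdash,\dashv\}$.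 Let $\mathbf{AssAdm}$ be the operad of associative admissible algebras: it is generated by two binary operations $\succ,\prec$ without symmetry, with the single relation that $a\succ b+a\prec b$ is associative. Then $$\mathbf{sDiAss}^!\cong\mathbf{AssAdm},$$ by an isomorphism of operads that sends $\vdash^*$ to $\succ$ and $\dashv^*$ to $\prec$, where $\vdash^*,\dashv^*$ is the dual basis. Moreover, let $V=\operatorname{span}(\vdash,\dashv)$, let $*=\vdash+\dashv$ and $\wedge=\vdash-\dashv$, and write $\mu\circ_1\nu=\mu(\nu(x_1,x_2),x_3)$ and $\mu\circ_2\nu=\mu(x_1,\nu(x_2,x_3))$. The span of all $\mu\circ_1\nu$ and $\mu\circ_2\nu$ with $\mu,\nu\in V$ (the arity $3$ component of the free nonsymmetric operad on $V$) has dimension $8$. The subspace $R$ spanned by the relations of $\mathbf{sDiAss}$ has dimension $7$ and equals $$R=\operatorname{span}\bigl(*\circ_1*-*\circ_2*,\ \wedge\circ_1*,\ \wedge\circ_2*,\ \wedge\circ_1\wedge,\ \wedge\circ_2\wedge,\ *\circ_1\wedge,\ *\circ_2\wedge\bigr).$$ Its orthogonal complement in the corresponding space for $V^*$ has dimension $1$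 and is spanned by the associativity relation $*^*\circ_1*^*-*^*\circ_2*^*$, where $*^*,\wedge^*$ is the basis of $V^*$ dual to $*,\wedge$. For the symmetric operads, the orthogonal complement of the $S_3$-submodule generated by $R$ is the $S_3$-submodule generated by this associativity relation. -/

import Mathlib

open TensorProduct

universe u

noncomputable section

/-! ### Symmetric operads

A `K`-linear symmetric operad, in the coordinate-free form: a functor from finite sets and
bijections to `K`-modules with a unit and partial compositions. Its arity `n` component is
`obj (Fin n)` with the action of the permutations of `Fin n` through `map`. -/

/-- `I ⊔ (J ⊔ {*}) ≃ (I ⊔ J) ⊔ {*}`. -/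
def sumOptionEquiv (I J : Type) : I ⊕ Option J ≃ Option (I ⊕ J) where
  toFun := Sum.elim (fun i => some (Sum.inl i)) (fun o => o.map Sum.inr)
  invFun o := o.elim (Sum.inr none) (Sum.elim Sum.inl (fun j => Sum.inr (some j)))
  left_inv := by rintro (_ | _ | _) <;> rfl
  right_inv := by rintro (_ | _ | _) <;> rfl

/-- `(I ⊔ {*}) ⊔ J ≃ (I ⊔ J) ⊔ {*}`. -/
def optionSumEquiv (I J : Type) : Option I ⊕ J ≃ Option (I ⊕ J) where
  toFun := Sum.elim (fun o => o.map Sum.inl) (fun j => some (Sum.inr j))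
  invFun o := o.elim (Sum.inl none) (Sum.elim (fun i => Sum.inl (some i)) Sum.inr)
  left_inv := by rintro ((_ | _) | _) <;> rfl
  right_inv := by rintro (_ | _ | _) <;> rfl

/-- The exchange of the two added points of `I ⊔ {*} ⊔ {*}`. -/
def optionOptionSwap (I : Type) : Option (Option I) ≃ Option (Option I) where
  toFun o := o.elim (some none) (fun o' => o'.elim none (fun i => some (some i)))
  invFun o := o.elim (some none) (fun o' => o'.elim none (fun i => some (some i)))
  left_inv := by rintro (_ | _ | _) <;> rfl
  right_inv := by rintro (_ | _ | _) <;> rfl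

/-- `(I ⊔ L) ⊔ J ≃ (I ⊔ J) ⊔ L`. -/
def sumRightSwap (I J L : Type) : (I ⊕ L) ⊕ J ≃ (I ⊕ J) ⊕ L where
  toFun := Sum.elim (Sum.elim (fun i => Sum.inl (Sum.inl i)) Sum.inr) (fun j => Sum.inl (Sum.inr j))
  invFun :=
    Sum.elim (Sum.elim (fun i => Sum.inl (Sum.inl i)) Sum.inr) (fun j => Sum.inl (Sum.inr j))
  left_inv := by rintro ((_ | _) | _) <;> rfl
  right_inv := by rintro ((_ | _) | _) <;> rfl

/-- `{*} ≃ ∅ ⊔ {*}`. -/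
def unitEquivOptionEmpty : Unit ≃ Option Empty where
  toFun _ := none
  invFun _ := ()
  left_inv _ := rfl
  right_inv := by rintro (_ | x); exacts [rfl, x.elim]

/-- A symmetric operad over `K`. The element `circ p q` is the partial composite `p ∘_* q`: `q` is
inserted into the input `* = none` of `p`. Partial composites at other inputs are obtained by
relabelling. -/
structure SymmOperad (K : Type u) [Field K] where
  obj : (I : Type) → [Finite I] → Type u
  [addCommGroup : ∀ (I : Type) [Finite I], AddCommGroup (obj I)]
  [module : ∀ (I : Type) [Finite I], Module K (obj I)]
  map : ∀ {I J : Type} [Finite I] [Finite J], (I ≃ J) → (obj I →ₗ[K] obj J)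
  one : obj Unit
  circ : ∀ {I J : Type} [Finite I] [Finite J],
    obj (Option I) →ₗ[K] obj J →ₗ[K] obj (I ⊕ J)
  map_refl : ∀ {I : Type} [Finite I] (p : obj I), map (Equiv.refl I) p = p
  map_trans : ∀ {I J L : Type} [Finite I] [Finite J] [Finite L] (e : I ≃ J) (f : J ≃ L)
    (p : obj I), map (e.trans f) p = map f (map e p)
  circ_map : ∀ {I I' J J' : Type} [Finite I] [Finite I'] [Finite J] [Finite J']
    (e : I ≃ I') (f : J ≃ J') (p : obj (Option I)) (q : obj J),
    circ (map (Equiv.optionCongr e) p) (map f q) = map (Equiv.sumCongr e f) (circ p q)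
  one_circ : ∀ {J : Type} [Finite J] (q : obj J),
    map (Equiv.emptySum Empty J) (circ (map unitEquivOptionEmpty one) q) = q
  circ_one : ∀ {I : Type} [Finite I] (p : obj (Option I)),
    map (Equiv.optionEquivSumPUnit I).symm (circ p one) = p
  /-- sequential composition -/
  circ_assoc : ∀ {I J L : Type} [Finite I] [Finite J] [Finite L]
    (p : obj (Option I)) (q : obj (Option J)) (r : obj L),
    map (Equiv.sumAssoc I J L) (circ (map (sumOptionEquiv I J) (circ p q)) r) =
      circ p (circ q r)
  /-- parallel composition -/
  circ_comm : ∀ {I J L : Type} [Finite I] [Finite J] [Finite L]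
    (p : obj (Option (Option I))) (q : obj J) (r : obj L),
    circ (map (optionSumEquiv I J) (circ p q)) r =
      map (sumRightSwap I J L)
        (circ (map (optionSumEquiv I L) (circ (map (optionOptionSwap I) p) r)) q)

attribute [instance] SymmOperad.addCommGroup SymmOperad.module

namespace SymmOperad

variable {K : Type u} [Field K]

/-- An isomorphism of symmetric operads. -/
structure Iso (P Q : SymmOperad K) where
  equiv : ∀ (I : Type) [Finite I], P.obj I ≃ₗ[K] Q.obj I
  equiv_map : ∀ {I J : Type} [Finite I] [Finite J] (e : I ≃ J) (p : P.obj I),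
    equiv J (P.map e p) = Q.map e (equiv I p)
  equiv_one : equiv Unit P.one = Q.one
  equiv_circ : ∀ {I J : Type} [Finite I] [Finite J] (p : P.obj (Option I)) (q : P.obj J),
    equiv (I ⊕ J) (P.circ p q) = Q.circ (equiv (Option I) p) (equiv J q)

/-- An operadic ideal. -/
structure OperadIdeal (P : SymmOperad K) where
  carrier : ∀ (I : Type) [Finite I], Submodule K (P.obj I)
  map_mem : ∀ {I J : Type} [Finite I] [Finite J] (e : I ≃ J) {p : P.obj I},
    p ∈ carrier I → P.map e p ∈ carrier J
  circ_mem_left : ∀ {I J : Type} [Finite I] [Finite J] {p : P.obj (Option I)} (q : P.obj J),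
    p ∈ carrier (Option I) → P.circ p q ∈ carrier (I ⊕ J)
  circ_mem_right : ∀ {I J : Type} [Finite I] [Finite J] (p : P.obj (Option I)) {q : P.obj J},
    q ∈ carrier J → P.circ p q ∈ carrier (I ⊕ J)

/-- The operadic ideal generated by a set of elements of arity `n`: the intersection of all the
operadic ideals that contain it. -/
def idealSpan (P : SymmOperad K) (n : ℕ) (S : Set (P.obj (Fin n))) : P.OperadIdeal where
  carrier I _ := sInf {M | ∃ A : P.OperadIdeal, S ⊆ A.carrier (Fin n) ∧ M = A.carrier I}
  map_mem e p hp := by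
    simp only [Submodule.mem_sInf] at hp ⊢
    rintro _ ⟨A, hA, rfl⟩
    exact A.map_mem e (hp _ ⟨A, hA, rfl⟩)
  circ_mem_left q hp := by
    simp only [Submodule.mem_sInf] at hp ⊢
    rintro _ ⟨A, hA, rfl⟩
    exact A.circ_mem_left q (hp _ ⟨A, hA, rfl⟩)
  circ_mem_right p q hq := by
    simp only [Submodule.mem_sInf] at hq ⊢
    rintro _ ⟨A, hA, rfl⟩
    exact A.circ_mem_right p (hq _ ⟨A, hA, rfl⟩)

theorem idealSpan_le (P : SymmOperad K) {n : ℕ} {S : Set (P.obj (Fin n))} (A : P.OperadIdeal)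
    (h : S ⊆ A.carrier (Fin n)) (I : Type) [Finite I] :
    (P.idealSpan n S).carrier I ≤ A.carrier I :=
  sInf_le ⟨A, h, rfl⟩

/-- The bilinear map that a bilinear map induces on quotients. -/
def mapQ₂ {K M N L : Type*} [Field K] [AddCommGroup M] [Module K M] [AddCommGroup N] [Module K N]
    [AddCommGroup L] [Module K L] (A : Submodule K M) (B : Submodule K N) (C : Submodule K L)
    (f : M →ₗ[K] N →ₗ[K] L) (hA : ∀ p ∈ A, ∀ q, f p q ∈ C) (hB : ∀ p, ∀ q ∈ B, f p q ∈ C) :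
    (M ⧸ A) →ₗ[K] (N ⧸ B) →ₗ[K] (L ⧸ C) :=
  A.liftQ
    { toFun := fun p => B.mapQ C (f p) (hB p)
      map_add' := by
        intro p p'
        apply Submodule.linearMap_qext
        ext q
        simp
      map_smul' := by
        intro c p
        apply Submodule.linearMap_qext
        ext q
        simp }
    (by
      intro p hp
      rw [LinearMap.mem_ker]
      apply Submodule.linearMap_qext
      ext q
      simpa using hA p hp q)

@[simp]
theorem mapQ₂_mk {K M N L : Type*} [Field K] [AddCommGroup M] [Module K M] [AddCommGroup N]
    [Module K N] [AddCommGroup L] [Module K L] (A : Submodule K M) (B : Submodule K N)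
    (C : Submodule K L) (f : M →ₗ[K] N →ₗ[K] L) (hA : ∀ p ∈ A, ∀ q, f p q ∈ C)
    (hB : ∀ p, ∀ q ∈ B, f p q ∈ C) (p : M) (q : N) :
    mapQ₂ A B C f hA hB (Submodule.Quotient.mk p) (Submodule.Quotient.mk q) =
      Submodule.Quotient.mk (f p q) :=
  rfl

/-- The quotient of an operad by an operadic ideal. -/
def quotient (P : SymmOperad K) (A : P.OperadIdeal) : SymmOperad K where
  obj I _ := P.obj I ⧸ A.carrier I
  map {I J} _ _ e := (A.carrier I).mapQ (A.carrier J) (P.map e) (fun _ hp => A.map_mem e hp)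
  one := (A.carrier Unit).mkQ P.one
  circ {I J} _ _ := mapQ₂ (A.carrier (Option I)) (A.carrier J) (A.carrier (I ⊕ J)) P.circ
    (fun _ hp q => A.circ_mem_left q hp) (fun p _ hq => A.circ_mem_right p hq)
  map_refl p := by
    obtain ⟨p, rfl⟩ := Submodule.mkQ_surjective _ p
    simp [P.map_refl]
  map_trans e f p := by
    obtain ⟨p, rfl⟩ := Submodule.mkQ_surjective _ p
    simp [P.map_trans]
  circ_map e f p q := by
    obtain ⟨p, rfl⟩ := Submodule.mkQ_surjective _ p
    obtain ⟨q, rfl⟩ := Submodule.mkQ_surjective _ q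
    simp [P.circ_map]
  one_circ q := by
    obtain ⟨q, rfl⟩ := Submodule.mkQ_surjective _ q
    simp [P.one_circ]
  circ_one p := by
    obtain ⟨p, rfl⟩ := Submodule.mkQ_surjective _ p
    simp [P.circ_one]
  circ_assoc p q r := by
    obtain ⟨p, rfl⟩ := Submodule.mkQ_surjective _ p
    obtain ⟨q, rfl⟩ := Submodule.mkQ_surjective _ q
    obtain ⟨r, rfl⟩ := Submodule.mkQ_surjective _ r
    simp [P.circ_assoc]
  circ_comm p q r := by
    obtain ⟨p, rfl⟩ := Submodule.mkQ_surjective _ p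
    obtain ⟨q, rfl⟩ := Submodule.mkQ_surjective _ q
    obtain ⟨r, rfl⟩ := Submodule.mkQ_surjective _ r
    simp [P.circ_comm (p := p)]

end SymmOperad

/-! ### Trees -/

/-- Planar binary trees with vertices decorated by `X` and leaves labelled by `I`. -/
inductive BTree (X : Type u) (I : Type) : Type u
  | leaf (i : I) : BTree X I
  | node (x : X) (l r : BTree X I) : BTree X I

namespace BTree

variable {X : Type u} {I J L : Type}

/-- Substitution of trees for the leaves. -/
def bind : BTree X I → (I → BTree X J) → BTree X J
  | leaf i, f => f i
  | node x l r, f => node x (l.bind f) (r.bind f)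

/-- The list of the labels of the leaves, from left to right. -/
def leaves : BTree X I → List I
  | leaf i => [i]
  | node _ l r => l.leaves ++ r.leaves

/-- Every label occurs at exactly one leaf. -/
def Multilinear (t : BTree X I) : Prop := t.leaves.Nodup ∧ ∀ i, i ∈ t.leaves

/-- Relabelling of the leaves. -/
def relabel (f : I → J) (t : BTree X I) : BTree X J := t.bind (fun i => leaf (f i))

/-- Grafting of the tree `t` at the leaf `none` of the tree `s`. -/
def graft (s : BTree X (Option I)) (t : BTree X J) : BTree X (I ⊕ J) :=
  s.bind (fun o => o.elim (t.relabel Sum.inr) (fun i => leaf (Sum.inl i)))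

theorem bind_bind (t : BTree X I) (f : I → BTree X J) (g : J → BTree X L) :
    (t.bind f).bind g = t.bind (fun i => (f i).bind g) := by
  induction t with
  | leaf i => rfl
  | node x l r hl hr => simp [bind, hl, hr]

theorem bind_leaf (t : BTree X I) : t.bind leaf = t := by
  induction t with
  | leaf i => rfl
  | node x l r hl hr => simp [bind, hl, hr]

theorem leaves_bind (t : BTree X I) (f : I → BTree X J) :
    (t.bind f).leaves = t.leaves.flatMap (fun i => (f i).leaves) := by
  induction t with
  | leaf i => simp [bind, leaves]
  | node x l r hl hr => simp [bind, leaves, hl, hr]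

theorem leaves_relabel (t : BTree X I) (f : I → J) :
    (t.relabel f).leaves = t.leaves.map f := by
  simp [relabel, leaves_bind, leaves, ← List.map_eq_flatMap]

theorem Multilinear.relabel {t : BTree X I} (h : t.Multilinear) (e : I ≃ J) :
    (t.relabel e).Multilinear := by
  refine ⟨?_, fun j => ?_⟩
  · rw [leaves_relabel]
    exact h.1.map e.injective
  · rw [leaves_relabel]
    exact List.mem_map.2 ⟨e.symm j, h.2 _, by simp⟩

theorem Multilinear.graft {s : BTree X (Option I)} {t : BTree X J} (hs : s.Multilinear)
    (ht : t.Multilinear) : (s.graft t).Multilinear := by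
  refine ⟨?_, ?_⟩
  · rw [BTree.graft, leaves_bind, List.nodup_flatMap]
    refine ⟨?_, hs.1.imp ?_⟩
    · rintro (_ | i) -
      · simpa [leaves_relabel] using ht.1.map Sum.inr_injective
      · simp [leaves]
    · rintro (_ | i) (_ | j) hij <;>
        simp_all [Function.onFun, leaves_relabel, leaves, List.Disjoint]
  · rw [BTree.graft, leaves_bind]
    rintro (i | j)
    · exact List.mem_flatMap.2 ⟨some i, hs.2 _, by simp [leaves]⟩
    · exact List.mem_flatMap.2 ⟨none, hs.2 _, by simpa [leaves_relabel] using ht.2 j⟩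

end BTree

/-- Planar binary trees with leaves labelled bijectively by `I`. -/
abbrev MTree (X : Type u) (I : Type) : Type u := {t : BTree X I // t.Multilinear}

namespace MTree

variable {X : Type u} {I J : Type}

/-- Relabelling. -/
def relabel (e : I ≃ J) (t : MTree X I) : MTree X J := ⟨t.1.relabel e, t.2.relabel e⟩

/-- Grafting at the leaf `none`. -/
def graft (s : MTree X (Option I)) (t : MTree X J) : MTree X (I ⊕ J) :=
  ⟨s.1.graft t.1, s.2.graft t.2⟩

/-- The tree with one leaf. -/
def unit : MTree X Unit := ⟨BTree.leaf (), by simp [BTree.Multilinear, BTree.leaves]⟩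

/-- The tree with one vertex. -/
def corolla (x : X) : MTree X (Fin 2) :=
  ⟨BTree.node x (BTree.leaf 0) (BTree.leaf 1), by
    simp [BTree.Multilinear, BTree.leaves, Fin.forall_fin_two]⟩

/-- The planar tree `x(y(0,1),2)`. -/
def left (x y : X) : MTree X (Fin 3) :=
  ⟨BTree.node x (BTree.node y (BTree.leaf 0) (BTree.leaf 1)) (BTree.leaf 2), by
    refine ⟨?_, fun i => ?_⟩
    · simp [BTree.leaves]
    · fin_cases i <;> simp [BTree.leaves]⟩

/-- The planar tree `x(0,y(1,2))`. -/
def right (x y : X) : MTree X (Fin 3) :=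
  ⟨BTree.node x (BTree.leaf 0) (BTree.node y (BTree.leaf 1) (BTree.leaf 2)), by
    refine ⟨?_, fun i => ?_⟩
    · simp [BTree.leaves]
    · fin_cases i <;> simp [BTree.leaves]⟩

end MTree

section TreeOperad

variable (K : Type u) [Field K] (X : Type u)

/-- The free operad on a set `X` of binary operations without symmetry: linear combinations of
binary trees with vertices decorated by `X`, composed by grafting. -/
def treeOperad : SymmOperad K where
  obj I _ := MTree X I →₀ K
  map e := Finsupp.lmapDomain K K (MTree.relabel e)
  one := Finsupp.single MTree.unit 1
  circ := Finsupp.linearCombination K (fun s => Finsupp.lmapDomain K K (MTree.graft s))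
  map_refl p := by
    induction p using Finsupp.induction_linear with
    | zero => simp
    | add p q hp hq => simp only [map_add, hp, hq]
    | single t c =>
      simp only [Finsupp.lmapDomain_apply, Finsupp.mapDomain_single]
      congr 1
      exact Subtype.ext (BTree.bind_leaf t.1)
  map_trans e f p := by
    induction p using Finsupp.induction_linear with
    | zero => simp
    | add p q hp hq => simp only [map_add, hp, hq]
    | single t c =>
      simp only [Finsupp.lmapDomain_apply, Finsupp.mapDomain_single]
      congr 1
      apply Subtype.ext
      simp [MTree.relabel, BTree.relabel, BTree.bind_bind, BTree.bind]
  circ_map e f p q := by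
    induction p using Finsupp.induction_linear with
    | zero => simp
    | add p q hp hq => simp only [map_add, LinearMap.add_apply, hp, hq]
    | single s c =>
    induction q using Finsupp.induction_linear with
    | zero => simp
    | add p q hp hq => simp only [map_add, hp, hq]
    | single t d =>
      simp only [Finsupp.lmapDomain_apply, Finsupp.mapDomain_single,
        Finsupp.linearCombination_single, LinearMap.smul_apply, Finsupp.smul_single]
      congr 1
      apply Subtype.ext
      simp only [MTree.relabel, BTree.relabel, MTree.graft, BTree.graft, BTree.bind_bind]
      congr 1
      funext o
      cases o <;> simp [BTree.bind_bind, BTree.bind]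
  one_circ q := by
    induction q using Finsupp.induction_linear with
    | zero => simp
    | add p q hp hq => simp only [map_add, hp, hq]
    | single t d =>
      simp only [Finsupp.lmapDomain_apply, Finsupp.mapDomain_single,
        Finsupp.linearCombination_single, one_smul]
      congr 1
      apply Subtype.ext
      simp [MTree.relabel, BTree.relabel, MTree.graft, BTree.graft, MTree.unit, BTree.bind_bind,
        BTree.bind, unitEquivOptionEmpty, BTree.bind_leaf]
  circ_one p := by
    induction p using Finsupp.induction_linear with
    | zero => simp
    | add p q hp hq => simp only [map_add, LinearMap.add_apply, hp, hq]
    | single s c =>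
      simp only [Finsupp.lmapDomain_apply, Finsupp.mapDomain_single,
        Finsupp.linearCombination_single, LinearMap.smul_apply, Finsupp.smul_single, smul_eq_mul,
        mul_one]
      congr 1
      apply Subtype.ext
      simp only [MTree.relabel, BTree.relabel, MTree.graft, BTree.graft, MTree.unit,
        BTree.bind_bind]
      conv_rhs => rw [← BTree.bind_leaf s.1]
      congr 1
      funext o
      cases o <;> simp [BTree.bind]
  circ_assoc p q r := by
    induction p using Finsupp.induction_linear with
    | zero => simp
    | add p q hp hq => simp only [map_add, LinearMap.add_apply, hp, hq]
    | single s c =>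
    induction q using Finsupp.induction_linear with
    | zero => simp
    | add p q hp hq => simp only [map_add, LinearMap.add_apply, hp, hq]
    | single t d =>
    induction r using Finsupp.induction_linear with
    | zero => simp
    | add p q hp hq => simp only [map_add, hp, hq]
    | single t' d' =>
      simp only [Finsupp.lmapDomain_apply, Finsupp.mapDomain_single,
        Finsupp.linearCombination_single, LinearMap.smul_apply, Finsupp.smul_single, smul_eq_mul,
        mul_assoc]
      congr 1
      apply Subtype.ext
      simp only [MTree.relabel, BTree.relabel, MTree.graft, BTree.graft, BTree.bind_bind]
      congr 1
      funext o
      cases o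
      · simp only [Option.elim, BTree.bind_bind, BTree.bind]
        congr 1
        funext o'
        cases o' <;> simp [BTree.bind_bind, BTree.bind, sumOptionEquiv]
      · simp [BTree.bind, sumOptionEquiv]
  circ_comm p q r := by
    induction p using Finsupp.induction_linear with
    | zero => simp
    | add p q hp hq => simp only [map_add, LinearMap.add_apply, hp, hq]
    | single s c =>
    induction q using Finsupp.induction_linear with
    | zero => simp
    | add p q hp hq => simp only [map_add, LinearMap.add_apply, hp, hq]
    | single t d =>
    induction r using Finsupp.induction_linear with
    | zero => simp
    | add p q hp hq => simp only [map_add, LinearMap.add_apply, hp, hq]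
    | single t' d' =>
      simp only [Finsupp.lmapDomain_apply, Finsupp.mapDomain_single,
        Finsupp.linearCombination_single, LinearMap.smul_apply, Finsupp.smul_single, smul_eq_mul]
      rw [mul_right_comm]
      congr 1
      apply Subtype.ext
      simp only [MTree.relabel, BTree.relabel, MTree.graft, BTree.graft, BTree.bind_bind]
      congr 1
      funext o
      rcases o with _ | _ | i <;>
        simp [BTree.bind_bind, BTree.bind, optionSumEquiv, optionOptionSwap, sumRightSwap]

end TreeOperad

section TreeBasis

variable {K : Type u} [Field K] {X : Type u} {I J : Type} [Finite I] [Finite J]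
  {M : Type*} [AddCommGroup M] [Module K M]

/-- A tree as an element of the tree operad. -/
def treeElt (K : Type u) [Field K] (t : MTree X I) : (treeOperad K X).obj I :=
  (Finsupp.single t 1 : MTree X I →₀ K)

/-- The linear map with given values on the trees. -/
def treeLift (f : MTree X I → M) : (treeOperad K X).obj I →ₗ[K] M :=
  Finsupp.linearCombination K f

theorem treeLift_elt (f : MTree X I → M) (t : MTree X I) :
    treeLift f (treeElt K t) = f t := by
  change Finsupp.linearCombination K f (Finsupp.single t 1) = f t
  simp

theorem treeElt_hom_ext {f g : (treeOperad K X).obj I →ₗ[K] M}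
    (h : ∀ t, f (treeElt K t) = g (treeElt K t)) : f = g := by
  change (MTree X I →₀ K) →ₗ[K] M at f
  change (MTree X I →₀ K) →ₗ[K] M at g
  change ∀ t, f (Finsupp.single t 1) = g (Finsupp.single t 1) at h
  have : f = g := Finsupp.lhom_ext' fun t => LinearMap.ext_ring (h t)
  exact this

theorem map_treeElt (e : I ≃ J) (t : MTree X I) :
    (treeOperad K X).map e (treeElt K t) = treeElt K (t.relabel e) := by
  change Finsupp.mapDomain _ (Finsupp.single t (1 : K)) = Finsupp.single _ 1
  rw [Finsupp.mapDomain_single]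

theorem circ_treeElt (s : MTree X (Option I)) (t : MTree X J) :
    (treeOperad K X).circ (treeElt K s) (treeElt K t) = treeElt K (s.graft t) := by
  change Finsupp.linearCombination K (fun s => Finsupp.lmapDomain K K (MTree.graft s))
    (Finsupp.single s 1) (Finsupp.single t 1) = Finsupp.single _ 1
  simp

end TreeBasis

namespace BTree

variable {K : Type u} [Field K] {X A : Type u} {I J : Type} [AddCommGroup A] [Module K A]

/-- The value of a tree in an algebra with bilinear operations `op x`. -/
def eval (op : X → A →ₗ[K] A →ₗ[K] A) (v : I → A) : BTree X I → A
  | leaf i => v i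
  | node x l r => op x (l.eval op v) (r.eval op v)

theorem eval_bind (op : X → A →ₗ[K] A →ₗ[K] A) (v : J → A) (t : BTree X I) (f : I → BTree X J) :
    (t.bind f).eval op v = t.eval op (fun i => (f i).eval op v) := by
  induction t with
  | leaf i => rfl
  | node x l r hl hr => simp [bind, eval, hl, hr]

theorem eval_congr (op : X → A →ₗ[K] A →ₗ[K] A) {v w : I → A} (t : BTree X I)
    (h : ∀ i ∈ t.leaves, v i = w i) : t.eval op v = t.eval op w := by
  induction t with
  | leaf i => exact h i (by simp [leaves])
  | node x l r hl hr =>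
    simp only [eval]
    rw [hl fun i hi => h i (by simp [leaves, hi]), hr fun i hi => h i (by simp [leaves, hi])]

theorem exists_eval_linear (op : X → A →ₗ[K] A →ₗ[K] A) (v : I → A) (t : BTree X (Option I))
    (h : t.leaves.Nodup) (hn : none ∈ t.leaves) :
    ∃ g : A →ₗ[K] A, ∀ a, t.eval op (fun o => o.elim a v) = g a := by
  induction t with
  | leaf i =>
    obtain rfl : none = i := by simpa [leaves] using hn
    exact ⟨LinearMap.id, fun a => rfl⟩
  | node x l r hl hr =>
    simp only [leaves, List.nodup_append, List.mem_append] at h hn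
    obtain ⟨h1, h2, h3⟩ := h
    rcases hn with hn | hn
    · obtain ⟨g, hg⟩ := hl h1 hn
      refine ⟨(op x).flip (r.eval op (fun o => o.elim 0 v)) ∘ₗ g, fun a => ?_⟩
      simp only [eval, hg, LinearMap.comp_apply, LinearMap.flip_apply]
      congr 1
      refine eval_congr op r fun i hi => ?_
      cases i with
      | none => exact absurd rfl (h3 _ hn _ hi)
      | some i => rfl
    · obtain ⟨g, hg⟩ := hr h2 hn
      refine ⟨op x (l.eval op (fun o => o.elim 0 v)) ∘ₗ g, fun a => ?_⟩
      simp only [eval, hg, LinearMap.comp_apply]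
      congr 2
      refine eval_congr op l fun i hi => ?_
      cases i with
      | none => exact absurd rfl (h3 _ hi _ hn)
      | some i => rfl

/-- The evaluation of the elements of the tree operad in an algebra. -/
def evalLin [Finite I] (op : X → A →ₗ[K] A →ₗ[K] A) (v : I → A) :
    (treeOperad K X).obj I →ₗ[K] A :=
  treeLift (fun t => t.1.eval op v)

theorem evalLin_map [Finite I] [Finite J] (op : X → A →ₗ[K] A →ₗ[K] A) (v : J → A) (e : I ≃ J)
    (p : (treeOperad K X).obj I) :
    evalLin op v ((treeOperad K X).map e p) = evalLin op (fun i => v (e i)) p := by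
  suffices h : evalLin op v ∘ₗ (treeOperad K X).map e = evalLin op (fun i => v (e i)) from
    LinearMap.congr_fun h p
  refine treeElt_hom_ext fun t => ?_
  rw [LinearMap.comp_apply, map_treeElt, evalLin, evalLin, treeLift_elt, treeLift_elt]
  simp [MTree.relabel, BTree.relabel, eval_bind, eval]

theorem eval_graft (op : X → A →ₗ[K] A →ₗ[K] A) (v : I ⊕ J → A) (s : BTree X (Option I))
    (t : BTree X J) :
    (s.graft t).eval op v = s.eval op
      (fun o => o.elim (t.eval op (fun j => v (Sum.inr j))) (fun i => v (Sum.inl i))) := by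
  simp only [BTree.graft, eval_bind]
  congr 1
  funext o
  cases o <;> simp [BTree.relabel, eval_bind, eval]

theorem evalLin_circ_left [Finite I] [Finite J] (op : X → A →ₗ[K] A →ₗ[K] A) (v : I ⊕ J → A)
    (p : (treeOperad K X).obj (Option I)) (t : MTree X J) :
    evalLin op v ((treeOperad K X).circ p (treeElt K t)) = evalLin op
      (fun o => o.elim (t.1.eval op (fun j => v (Sum.inr j))) (fun i => v (Sum.inl i))) p := by
  suffices h : evalLin op v ∘ₗ (treeOperad K X).circ.flip (treeElt K t) = evalLin op
      (fun o => o.elim (t.1.eval op (fun j => v (Sum.inr j))) (fun i => v (Sum.inl i))) from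
    LinearMap.congr_fun h p
  refine treeElt_hom_ext fun s => ?_
  rw [LinearMap.comp_apply, LinearMap.flip_apply, circ_treeElt, evalLin, evalLin, treeLift_elt,
    treeLift_elt, MTree.graft, eval_graft]

theorem exists_evalLin_circ_right [Finite I] [Finite J] (op : X → A →ₗ[K] A →ₗ[K] A)
    (v : I ⊕ J → A) (s : MTree X (Option I)) :
    ∃ g : A →ₗ[K] A, ∀ q : (treeOperad K X).obj J,
      evalLin op v ((treeOperad K X).circ (treeElt K s) q) =
        g (evalLin op (fun j => v (Sum.inr j)) q) := by
  obtain ⟨g, hg⟩ := exists_eval_linear op (fun i => v (Sum.inl i)) s.1 s.2.1 (s.2.2 none)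
  refine ⟨g, fun q => ?_⟩
  suffices h : evalLin op v ∘ₗ (treeOperad K X).circ (treeElt K s) =
      g ∘ₗ evalLin op (fun j => v (Sum.inr j)) from LinearMap.congr_fun h q
  refine treeElt_hom_ext fun t => ?_
  rw [LinearMap.comp_apply, LinearMap.comp_apply, circ_treeElt, evalLin, evalLin, treeLift_elt,
    treeLift_elt, MTree.graft, eval_graft, hg]

/-- The ideal of the combinations of trees that vanish identically in an algebra. -/
def annihilator (op : X → A →ₗ[K] A →ₗ[K] A) : (treeOperad K X).OperadIdeal where
  carrier I _ := ⨅ v : I → A, LinearMap.ker (evalLin op v)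
  map_mem {I J} _ _ e p hp := by
    simp only [Submodule.mem_iInf, LinearMap.mem_ker] at hp ⊢
    intro v
    rw [evalLin_map, hp]
  circ_mem_left {I J} _ _ p q hp := by
    simp only [Submodule.mem_iInf, LinearMap.mem_ker] at hp ⊢
    intro v
    suffices h : evalLin op v ∘ₗ (treeOperad K X).circ p = 0 from LinearMap.congr_fun h q
    refine treeElt_hom_ext fun t => ?_
    rw [LinearMap.comp_apply, evalLin_circ_left, hp, LinearMap.zero_apply]
  circ_mem_right {I J} _ _ p q hq := by
    simp only [Submodule.mem_iInf, LinearMap.mem_ker] at hq ⊢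
    intro v
    suffices h : evalLin op v ∘ₗ (treeOperad K X).circ.flip q = 0 from LinearMap.congr_fun h p
    refine treeElt_hom_ext fun s => ?_
    obtain ⟨g, hg⟩ := exists_evalLin_circ_right op v s
    rw [LinearMap.comp_apply, LinearMap.flip_apply, hg, hq, map_zero, LinearMap.zero_apply]

/-- The shapes of the trees with three leaves. -/
theorem Multilinear.cases_three {t : BTree X (Fin 3)} (h : t.Multilinear) :
    ∃ (x y : X) (a b c : Fin 3), a ≠ b ∧ a ≠ c ∧ b ≠ c ∧
      (t = node x (node y (leaf a) (leaf b)) (leaf c) ∨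
        t = node x (leaf c) (node y (leaf a) (leaf b))) := by
  have hpos : ∀ s : BTree X (Fin 3), 0 < s.leaves.length := by
    intro s
    induction s with
    | leaf i => simp [leaves]
    | node x l r hl hr => simp only [leaves, List.length_append]; omega
  have hone : ∀ s : BTree X (Fin 3), s.leaves.length = 1 → ∃ i, s = leaf i := by
    rintro (i | ⟨x, l, r⟩) hs
    · exact ⟨i, rfl⟩
    · have := hpos l
      have := hpos r
      simp only [leaves, List.length_append] at hs
      omega
  have htwo : ∀ s : BTree X (Fin 3), s.leaves.length = 2 →
      ∃ y i j, s = node y (leaf i) (leaf j) := by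
    rintro (i | ⟨x, l, r⟩) hs
    · simp [leaves] at hs
    · have := hpos l
      have := hpos r
      simp only [leaves, List.length_append] at hs
      obtain ⟨i, rfl⟩ := hone l (by omega)
      obtain ⟨j, rfl⟩ := hone r (by omega)
      exact ⟨x, i, j, rfl⟩
  have hlen : t.leaves.length = 3 := by
    have h1 : t.leaves.toFinset = Finset.univ := by
      ext i
      simp [h.2 i]
    rw [← List.toFinset_card_of_nodup h.1, h1]
    simp
  have hnd := h.1
  rcases t with i | ⟨x, l, r⟩
  · simp [leaves] at hlen
  have h1 := hpos l
  have h2 := hpos r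
  simp only [leaves, List.length_append] at hlen
  by_cases hl : l.leaves.length = 1
  · obtain ⟨c, rfl⟩ := hone l hl
    obtain ⟨y, a, b, rfl⟩ := htwo r (by omega)
    simp [leaves] at hnd
    exact ⟨x, y, a, b, c, hnd.2, Ne.symm hnd.1.1, Ne.symm hnd.1.2, Or.inr rfl⟩
  · obtain ⟨c, rfl⟩ := hone r (by omega)
    obtain ⟨y, a, b, rfl⟩ := htwo l (by omega)
    simp [leaves] at hnd
    exact ⟨x, y, a, b, c, hnd.1.1, hnd.1.2, hnd.2, Or.inl rfl⟩

end BTree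

/-! ### The free operad on an `S₂`-module -/

/-- A representation of the symmetric group on two letters: a module with an involution. -/
structure S2Module (K : Type u) [Field K] where
  carrier : Type u
  [addCommGroup : AddCommGroup carrier]
  [module : Module K carrier]
  swap : carrier →ₗ[K] carrier
  swap_swap : ∀ e, swap (swap e) = e

attribute [instance] S2Module.addCommGroup S2Module.module

namespace S2Module

variable {K : Type u} [Field K]

/-- `V ⊗ K[S₂]`, that is, `V` as a space of binary operations without symmetry. The operation `v`
is `(v, 0)`, and `(0, v)` is the opposite operation. -/
def regular (K : Type u) [Field K] (V : Type u) [AddCommGroup V] [Module K V] : S2Module K where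
  carrier := V × V
  swap := (LinearEquiv.prodComm K V V).toLinearMap
  swap_swap _ := rfl

/-- `E^∨ = E^* ⊗ sgn`. -/
def signDual (E : S2Module K) : S2Module K where
  carrier := Module.Dual K E.carrier
  swap := -E.swap.dualMap
  swap_swap α := by
    ext e
    simp [E.swap_swap]

variable (E : S2Module K)

/-- The element `e(0,1)` of the tree operad on the set `E`. -/
def preCorolla (e : E.carrier) : (treeOperad K E.carrier).obj (Fin 2) :=
  treeElt K (MTree.corolla e)

/-- The elements of arity two that have to vanish for the decorations of the vertices to be
linear and compatible with the action of `S₂`. -/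
def linearityRelations : Set ((treeOperad K E.carrier).obj (Fin 2)) :=
  {x | ∃ e f : E.carrier, x = E.preCorolla (e + f) - E.preCorolla e - E.preCorolla f} ∪
  {x | ∃ (c : K) (e : E.carrier), x = E.preCorolla (c • e) - c • E.preCorolla e} ∪
  {x | ∃ e : E.carrier, x = E.preCorolla (E.swap e) -
    (treeOperad K E.carrier).map (Equiv.swap 0 1) (E.preCorolla e)}

/-- The free symmetric operad `F(E)` on the `S₂`-module `E`, placed in arity two. -/
def freeOperad : SymmOperad K :=
  (treeOperad K E.carrier).quotient
    ((treeOperad K E.carrier).idealSpan 2 E.linearityRelations)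

/-- The class of a tree in the free operad. -/
def ofTree {I : Type} [Finite I] (t : MTree E.carrier I) : E.freeOperad.obj I :=
  Submodule.Quotient.mk (treeElt K t)

/-- The generator `e`. -/
def corolla (e : E.carrier) : E.freeOperad.obj (Fin 2) := E.ofTree (MTree.corolla e)

/-- `μ ∘₁ ν`, the operation `μ(ν(x₁,x₂),x₃)`. -/
def circ₁ (μ ν : E.carrier) : E.freeOperad.obj (Fin 3) := E.ofTree (MTree.left μ ν)

/-- `μ ∘₂ ν`, the operation `μ(x₁,ν(x₂,x₃))`. -/
def circ₂ (μ ν : E.carrier) : E.freeOperad.obj (Fin 3) := E.ofTree (MTree.right μ ν)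

/-! ### The pairing

The space `F(E)(3)` is the sum of three copies of `E ⊗ E`: the summand with index `c` holds the
compositions `μ(ν(x_a,x_b),x_c)`, where `(a,b,c)` is a cyclic permutation of `(0,1,2)`. -/

/-- The coordinates of a tree with three leaves in the three copies of `E ⊗ E`. -/
def treeCoord : BTree E.carrier (Fin 3) → Fin 3 → E.carrier ⊗[K] E.carrier
  | .node μ (.node ν (.leaf a) (.leaf b)) (.leaf c) =>
      Pi.single c (μ ⊗ₜ (if b = a + 1 then ν else E.swap ν))
  | .node μ (.leaf c) (.node ν (.leaf a) (.leaf b)) =>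
      Pi.single c (E.swap μ ⊗ₜ (if b = a + 1 then ν else E.swap ν))
  | _ => 0

/-- An algebra over the free operad on `E` in which the trees with three leaves, evaluated at the
three generators, are told apart. -/
abbrev TestAlg : Type u :=
  (Fin 3 → K) × (Fin 3 → E.carrier) × (Fin 3 → E.carrier ⊗[K] E.carrier)

/-- The operations of this algebra. -/
def testOp (e : E.carrier) : E.TestAlg →ₗ[K] E.TestAlg →ₗ[K] E.TestAlg :=
  LinearMap.mk₂ K
    (fun p q => (0,
      fun c => (p.1 (c + 1) * q.1 (c + 2)) • e + (p.1 (c + 2) * q.1 (c + 1)) • E.swap e,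
      fun c => q.1 c • (e ⊗ₜ p.2.1 c) + p.1 c • (E.swap e ⊗ₜ q.2.1 c)))
    (by
      intro p p' q
      ext c
      · simp
      · simp only [Prod.fst_add, Prod.snd_add, Pi.add_apply]; module
      · simp only [Prod.fst_add, Prod.snd_add, Pi.add_apply, tmul_add]; module)
    (by
      intro k p q
      ext c
      · simp
      · simp only [Prod.smul_fst, Prod.smul_snd, Pi.smul_apply, smul_eq_mul]; module
      · simp only [Prod.smul_fst, Prod.smul_snd, Pi.smul_apply, smul_eq_mul, tmul_smul]; module)
    (by
      intro p q q'
      ext c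
      · simp
      · simp only [Prod.fst_add, Prod.snd_add, Pi.add_apply]; module
      · simp only [Prod.fst_add, Prod.snd_add, Pi.add_apply, tmul_add]; module)
    (by
      intro k p q
      ext c
      · simp
      · simp only [Prod.smul_fst, Prod.smul_snd, Pi.smul_apply, smul_eq_mul]; module
      · simp only [Prod.smul_fst, Prod.smul_snd, Pi.smul_apply, smul_eq_mul, tmul_smul]; module)

theorem testOp_add (e f : E.carrier) : E.testOp (e + f) = E.testOp e + E.testOp f := by
  refine LinearMap.ext₂ fun p q => ?_
  simp only [testOp, LinearMap.mk₂_apply, LinearMap.add_apply, map_add, add_tmul]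
  ext c
  · simp
  · simp only [Prod.snd_add, Prod.fst_add, Pi.add_apply]; module
  · simp only [Prod.snd_add, Pi.add_apply]; module

theorem testOp_smul (k : K) (e : E.carrier) : E.testOp (k • e) = k • E.testOp e := by
  refine LinearMap.ext₂ fun p q => ?_
  simp only [testOp, LinearMap.mk₂_apply, LinearMap.smul_apply, map_smul]
  ext c
  · simp
  · simp only [Prod.smul_snd, Prod.smul_fst, Pi.smul_apply]; module
  · simp only [Prod.smul_snd, Pi.smul_apply, smul_tmul', smul_add]
    simp only [← smul_tmul', smul_comm k]

theorem testOp_swap (e : E.carrier) (p q : E.TestAlg) :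
    E.testOp (E.swap e) p q = E.testOp e q p := by
  simp only [testOp, LinearMap.mk₂_apply, E.swap_swap]
  ext c
  · simp
  · simp only [mul_comm]; abel
  · simp only; abel

/-- The three generators. -/
def testGen (i : Fin 3) : E.TestAlg := (Pi.single i 1, 0, 0)

theorem treeCoord_eq_eval {t : BTree E.carrier (Fin 3)} (h : t.Multilinear) :
    E.treeCoord t = (t.eval E.testOp E.testGen).2.2 := by
  obtain ⟨x, y, a, b, c, hab, hac, hbc, rfl | rfl⟩ := h.cases_three
  all_goals
    funext d
    simp only [treeCoord, BTree.eval, testOp, testGen, LinearMap.mk₂_apply]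
    fin_cases a <;> fin_cases b <;> fin_cases c <;> first
      | exact absurd rfl hab
      | exact absurd rfl hac
      | exact absurd rfl hbc
      | fin_cases d <;> simp

theorem linearity_le_ker :
    ((treeOperad K E.carrier).idealSpan 2 E.linearityRelations).carrier (Fin 3) ≤
      LinearMap.ker (treeLift (K := K)
        (fun t : MTree E.carrier (Fin 3) => E.treeCoord t.1)) := by
  refine (SymmOperad.idealSpan_le _ (BTree.annihilator E.testOp) ?_ _).trans ?_
  · have h : ∀ (v : Fin 2 → E.TestAlg) (e : E.carrier),
        BTree.evalLin E.testOp v (E.preCorolla e) = E.testOp e (v 0) (v 1) :=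
      fun v e => treeLift_elt _ _
    rintro x ((⟨e, f, rfl⟩ | ⟨k, e, rfl⟩) | ⟨e, rfl⟩)
    all_goals
      simp only [BTree.annihilator, SetLike.mem_coe, Submodule.mem_iInf, LinearMap.mem_ker]
      intro v
    · simp [h, testOp_add]
    · simp [h, testOp_smul]
    · rw [map_sub, BTree.evalLin_map, h, h, testOp_swap]
      simp
  · intro x hx
    simp only [BTree.annihilator, Submodule.mem_iInf, LinearMap.mem_ker] at hx
    have h : treeLift (K := K) (fun t : MTree E.carrier (Fin 3) => E.treeCoord t.1) =
        LinearMap.snd K _ _ ∘ₗ LinearMap.snd K _ _ ∘ₗ BTree.evalLin E.testOp E.testGen := by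
      refine treeElt_hom_ext fun t => ?_
      rw [treeLift_elt, E.treeCoord_eq_eval t.2, LinearMap.comp_apply, LinearMap.comp_apply,
        BTree.evalLin, treeLift_elt]
      rfl
    rw [LinearMap.mem_ker, h, LinearMap.comp_apply, LinearMap.comp_apply, hx, map_zero, map_zero]

/-- The coordinates of an element of `F(E)(3)` in the three copies of `E ⊗ E`. -/
def coord : E.freeOperad.obj (Fin 3) →ₗ[K] (Fin 3 → E.carrier ⊗[K] E.carrier) :=
  Submodule.liftQ _ (treeLift (K := K)
    (fun t : MTree E.carrier (Fin 3) => E.treeCoord t.1)) E.linearity_le_ker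

theorem coord_ofTree (t : MTree E.carrier (Fin 3)) : E.coord (E.ofTree t) = E.treeCoord t.1 :=
  treeLift_elt _ _

/-- The evaluation `⟨α ⊗ β, μ ⊗ ν⟩ = α(μ) β(ν)`. -/
def dualEval : E.signDual.carrier ⊗[K] E.signDual.carrier →ₗ[K]
    E.carrier ⊗[K] E.carrier →ₗ[K] K :=
  TensorProduct.dualDistrib K E.carrier E.carrier

/-- An element of `E^∨` as a functional on `E`. -/
def asDual (α : E.signDual.carrier) : Module.Dual K E.carrier := α

theorem dualEval_tmul (α β : E.signDual.carrier) (μ ν : E.carrier) :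
    E.dualEval (α ⊗ₜ β) (μ ⊗ₜ ν) = E.asDual α μ * E.asDual β ν :=
  rfl

theorem asDual_swap (α : E.signDual.carrier) (μ : E.carrier) :
    E.asDual (E.signDual.swap α) μ = - E.asDual α (E.swap μ) :=
  rfl

theorem dualEval_swap (a : E.signDual.carrier ⊗[K] E.signDual.carrier)
    (b : E.carrier ⊗[K] E.carrier) :
    E.dualEval (E.signDual.swap.lTensor _ a) (E.swap.lTensor _ b) = - E.dualEval a b := by
  induction a using TensorProduct.induction_on with
  | zero => simp
  | add a a' h h' =>
    simp only [map_add, LinearMap.add_apply, h, h']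
    abel
  | tmul α β =>
    induction b using TensorProduct.induction_on with
    | zero => simp
    | add b b' h h' =>
      simp only [map_add, h, h']
      abel
    | tmul μ ν =>
      rw [LinearMap.lTensor_tmul, LinearMap.lTensor_tmul, dualEval_tmul, dualEval_tmul,
        asDual_swap, E.swap_swap, mul_neg]

/-- The scalar product `F(E^∨)(3) ⊗ F(E)(3) → K`:
`⟨α ⊗ β in the copy u, μ ⊗ ν in the copy v⟩` is `α(μ) β(ν)` if `u = v` and `0` otherwise. -/
def pairing : E.signDual.freeOperad.obj (Fin 3) →ₗ[K] E.freeOperad.obj (Fin 3) →ₗ[K] K :=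
  ∑ u : Fin 3, E.dualEval.compl₁₂
    (LinearMap.proj u ∘ₗ E.signDual.coord) (LinearMap.proj u ∘ₗ E.coord)

theorem map_ofTree {I J : Type} [Finite I] [Finite J] (σ : I ≃ J) (t : MTree E.carrier I) :
    E.freeOperad.map σ (E.ofTree t) = E.ofTree (t.relabel σ) :=
  congrArg Submodule.Quotient.mk (map_treeElt σ t)

theorem ofTree_hom_ext {I : Type} [Finite I] {M : Type*} [AddCommGroup M] [Module K M]
    {f g : E.freeOperad.obj I →ₗ[K] M} (h : ∀ t, f (E.ofTree t) = g (E.ofTree t)) : f = g :=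
  Submodule.linearMap_qext _ (treeElt_hom_ext h)

theorem coord_map (σ : Equiv.Perm (Fin 3)) (x : E.freeOperad.obj (Fin 3)) (c : Fin 3) :
    E.coord (E.freeOperad.map σ x) (σ c) =
      if Equiv.Perm.sign σ = 1 then E.coord x c else E.swap.lTensor E.carrier (E.coord x c) := by
  have hσ : ∀ (σ : Equiv.Perm (Fin 3)) (a b : Fin 3), a ≠ b →
      (σ b = σ a + 1 ↔ if Equiv.Perm.sign σ = 1 then b = a + 1 else ¬ b = a + 1) := by decide
  suffices h : LinearMap.proj (σ c) ∘ₗ E.coord ∘ₗ E.freeOperad.map σ =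
      (if Equiv.Perm.sign σ = 1 then LinearMap.id else E.swap.lTensor E.carrier) ∘ₗ
        LinearMap.proj c ∘ₗ E.coord by
    refine (LinearMap.congr_fun h x).trans ?_
    split_ifs <;> rfl
  refine E.ofTree_hom_ext fun t => ?_
  simp only [LinearMap.comp_apply, LinearMap.proj_apply, map_ofTree, coord_ofTree]
  obtain ⟨t, h⟩ := t
  obtain ⟨x, y, a, b, d, hab, hac, hbc, rfl | rfl⟩ := h.cases_three
  all_goals
    simp only [MTree.relabel, BTree.relabel, BTree.bind, treeCoord, hσ σ a b hab,
      Pi.single_apply, σ.injective.eq_iff]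
    by_cases hs : Equiv.Perm.sign σ = 1 <;> by_cases hb : b = a + 1 <;> by_cases hc : c = d <;>
      simp [hs, hb, hc, E.swap_swap]

theorem pairing_apply (x : E.signDual.freeOperad.obj (Fin 3)) (y : E.freeOperad.obj (Fin 3)) :
    E.pairing x y = ∑ u : Fin 3, E.dualEval (E.signDual.coord x u) (E.coord y u) := by
  simp [pairing]

theorem pairing_map (σ : Equiv.Perm (Fin 3)) (x : E.signDual.freeOperad.obj (Fin 3))
    (y : E.freeOperad.obj (Fin 3)) :
    E.pairing (E.signDual.freeOperad.map σ x) (E.freeOperad.map σ y) =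
      ((Equiv.Perm.sign σ : ℤ) : K) * E.pairing x y := by
  simp only [pairing_apply, Finset.mul_sum]
  rw [← Equiv.sum_comp σ]
  refine Finset.sum_congr rfl fun c _ => ?_
  rw [coord_map, coord_map]
  rcases Int.units_eq_one_or (Equiv.Perm.sign σ) with h | h
  · simp [h]
  · have h' : ¬ ((-1 : ℤˣ) = 1) := by decide
    simp only [h, h', if_false, dualEval_swap]
    simp

/-- The orthogonal complement `R^⊥ ⊆ F(E^∨)(3)` of `R ⊆ F(E)(3)`. -/
def orthogonal (R : Submodule K (E.freeOperad.obj (Fin 3))) :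
    Submodule K (E.signDual.freeOperad.obj (Fin 3)) where
  carrier := {x | ∀ y ∈ R, E.pairing x y = 0}
  zero_mem' := by simp
  add_mem' hx hy z hz := by simp [hx z hz, hy z hz]
  smul_mem' k x hx z hz := by simp [hx z hz]

/-- The `S₃`-submodule of `F(E)(3)` generated by a set. -/
def symSpan (S : Set (E.freeOperad.obj (Fin 3))) : Submodule K (E.freeOperad.obj (Fin 3)) :=
  Submodule.span K {x | ∃ (σ : Equiv.Perm (Fin 3)) (s : E.freeOperad.obj (Fin 3)),
    s ∈ S ∧ x = E.freeOperad.map σ s}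

theorem map_mem_symSpan (S : Set (E.freeOperad.obj (Fin 3))) {σ : Equiv.Perm (Fin 3)}
    {x : E.freeOperad.obj (Fin 3)} (hx : x ∈ E.symSpan S) :
    E.freeOperad.map σ x ∈ E.symSpan S := by
  induction hx using Submodule.span_induction with
  | mem x hx =>
    obtain ⟨τ, s, hs, rfl⟩ := hx
    exact Submodule.subset_span ⟨τ.trans σ, s, hs, (SymmOperad.map_trans _ _ _ _).symm⟩
  | zero => simp
  | add x y _ _ hx hy =>
    rw [map_add]
    exact add_mem hx hy
  | smul k x _ hx =>
    rw [map_smul]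
    exact Submodule.smul_mem _ _ hx

/-- The associativity relation `μ(μ(x₁,x₂),x₃) - μ(x₁,μ(x₂,x₃))`. -/
def associator (μ : E.carrier) : E.freeOperad.obj (Fin 3) := E.circ₁ μ μ - E.circ₂ μ μ

/-- The span of the compositions `μ(ν(x₁,x₂),x₃)` and `μ(x₁,ν(x₂,x₃))` with `μ, ν ∈ W`. -/
def planarSpan (W : Set E.carrier) : Submodule K (E.freeOperad.obj (Fin 3)) :=
  Submodule.span K {x | ∃ μ ∈ W, ∃ ν ∈ W, x = E.circ₁ μ ν ∨ x = E.circ₂ μ ν}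

end S2Module

/-! ### Binary quadratic operads and their Koszul duals -/

/-- Binary quadratic data `(E, R)`: a finite-dimensional `S₂`-module `E` of generators and an
`S₃`-submodule `R ⊆ F(E)(3)` of relations. -/
structure QuadraticData (K : Type u) [Field K] where
  gen : S2Module K
  finite : Module.Finite K gen.carrier
  rel : Submodule K (gen.freeOperad.obj (Fin 3))
  map_mem_rel : ∀ (σ : Equiv.Perm (Fin 3)) (x : gen.freeOperad.obj (Fin 3)),
    x ∈ rel → gen.freeOperad.map σ x ∈ rel

namespace QuadraticData

variable {K : Type u} [Field K]

/-- The binary quadratic operad `P(E,R) = F(E)/(R)`. -/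
def operad (D : QuadraticData K) : SymmOperad K :=
  D.gen.freeOperad.quotient (D.gen.freeOperad.idealSpan 3 D.rel)

/-- The class of a generator in `P(E,R)(2)`. -/
def generator (D : QuadraticData K) (e : D.gen.carrier) : D.operad.obj (Fin 2) :=
  Submodule.Quotient.mk (D.gen.corolla e)

/-- The Koszul dual of `P(E,R)` is `P(E^∨,R^⊥)`. -/
def koszulDual (D : QuadraticData K) : QuadraticData K where
  gen := D.gen.signDual
  finite := by
    have := D.finite
    exact inferInstanceAs (Module.Finite K (Module.Dual K D.gen.carrier))
  rel := D.gen.orthogonal D.rel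
  map_mem_rel σ x hx y hy := by
    have h := D.gen.pairing_map σ x (D.gen.freeOperad.map σ.symm y)
    rw [← SymmOperad.map_trans, Equiv.symm_trans_self, SymmOperad.map_refl,
      hx _ (D.map_mem_rel _ _ hy), mul_zero] at h
    exact h

/-- The quadratic data with the generators `E` and the relations `S`, closed under `S₃`. -/
def ofRelations (E : S2Module K) [Module.Finite K E.carrier]
    (S : Set (E.freeOperad.obj (Fin 3))) : QuadraticData K where
  gen := E
  finite := inferInstance
  rel := E.symSpan S
  map_mem_rel _ _ hx := E.map_mem_symSpan S hx

end QuadraticData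

/-! ### Symmetric dialgebras and associative admissible algebras -/

section TwoOperations

variable (K : Type u) [Field K]

/-- Two binary operations without symmetry, spanning `V = K × K`: the `S₂`-module
`V ⊗ K[S₂]`. -/
abbrev twoOps : S2Module K := S2Module.regular K (K × K)

instance : Module.Finite K (twoOps K).carrier :=
  inferInstanceAs (Module.Finite K ((K × K) × (K × K)))

/-- An element of `V` as a generator. -/
def nsOp (v : K × K) : (twoOps K).carrier := (v, (0 : K × K))

/-- An element of `V^*` as a generator of the Koszul dual: it vanishes on the opposite
operations. -/
def nsDualOp (α : Module.Dual K (K × K)) : (twoOps K).signDual.carrier :=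
  α ∘ₗ LinearMap.fst K (K × K) (K × K)

/-- The first operation: `⊢` of a symmetric dialgebra, `≻` of an ass.-admissible algebra. -/
def op₁ : (twoOps K).carrier := nsOp K (1, 0)

/-- The second operation: `⊣` of a symmetric dialgebra, `≺` of an ass.-admissible algebra. -/
def op₂ : (twoOps K).carrier := nsOp K (0, 1)

/-- The functional `⊢^*` of the basis dual to `⊢, ⊣`. -/
def dualOp₁ : (twoOps K).signDual.carrier := nsDualOp K (LinearMap.fst K K K)

/-- The functional `⊣^*` of the basis dual to `⊢, ⊣`. -/
def dualOp₂ : (twoOps K).signDual.carrier := nsDualOp K (LinearMap.snd K K K)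

/-- The relations `(a ∘₁ b) ∘₂ c = a ∘₃ (b ∘₄ c)` of symmetric dialgebras, for all choices of
`∘₁, ∘₂, ∘₃, ∘₄` among `⊢, ⊣`. -/
def sDiAssRelations : Set ((twoOps K).freeOperad.obj (Fin 3)) :=
  {x | ∃ m₁ ∈ ({op₁ K, op₂ K} : Set (twoOps K).carrier),
    ∃ m₂ ∈ ({op₁ K, op₂ K} : Set (twoOps K).carrier),
    ∃ m₃ ∈ ({op₁ K, op₂ K} : Set (twoOps K).carrier),
    ∃ m₄ ∈ ({op₁ K, op₂ K} : Set (twoOps K).carrier),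
    x = (twoOps K).circ₁ m₂ m₁ - (twoOps K).circ₂ m₃ m₄}

/-- The quadratic data of the operad of symmetric dialgebras. -/
def sDiAss : QuadraticData K := QuadraticData.ofRelations (twoOps K) (sDiAssRelations K)

/-- The quadratic data of the operad of ass.-admissible algebras: two operations `≻, ≺` such that
`≻ + ≺` is associative. -/
def AssAdm : QuadraticData K :=
  QuadraticData.ofRelations (twoOps K) {(twoOps K).associator (op₁ K + op₂ K)}

/-- `* = ⊢ + ⊣`. -/
def starOp : (twoOps K).carrier := op₁ K + op₂ K

/-- `∧ = ⊢ - ⊣`. -/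
def wedgeOp : (twoOps K).carrier := op₁ K - op₂ K

/-- The functional `*^*` of the basis dual to `*, ∧`. -/
def dualStar : (twoOps K).signDual.carrier :=
  nsDualOp K ((2 : K)⁻¹ • (LinearMap.fst K K K + LinearMap.snd K K K))

theorem dualStar_starOp [CharZero K] :
    (twoOps K).asDual (dualStar K) (starOp K) = 1 := by
  change (2 : K)⁻¹ * ((1 + 0) + (0 + 1)) = 1
  norm_num

theorem dualStar_wedgeOp :
    (twoOps K).asDual (dualStar K) (wedgeOp K) = 0 := by
  change (2 : K)⁻¹ * ((1 - 0) + (0 - 1)) = 0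
  norm_num

/-- The arity three component of the free nonsymmetric operad on `V`, inside that of the free
symmetric operad on `V ⊗ K[S₂]`: the span of the planar trees whose leaves are labelled in
order. -/
def nsArityThree : Submodule K ((twoOps K).freeOperad.obj (Fin 3)) :=
  (twoOps K).planarSpan (Set.range (nsOp K))

/-- The same for `V^*`. -/
def nsDualArityThree : Submodule K ((twoOps K).signDual.freeOperad.obj (Fin 3)) :=
  (twoOps K).signDual.planarSpan (Set.range (nsDualOp K))

/-- The nonsymmetric relation space of symmetric dialgebras. -/
def sDiAssNsRel : Submodule K ((twoOps K).freeOperad.obj (Fin 3)) :=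
  Submodule.span K (sDiAssRelations K)

end TwoOperations

end

/-! The computation takes place on planar trees. Composites of `⊢, ⊣` and composites of the dual
basis pair diagonally, with entry `1` on each `∘₁` composite and `-1` on each `∘₂` composite
(`pairing_planarFamily`). The minus sign comes from the sign twist in `E^∨`: a `∘₂` composite lies
in its copy of `E ⊗ E` with its root operation swapped. In particular the eight planar composites
are independent.

In these coordinates the relations of symmetric dialgebras are all differences of a `∘₁` basis
vector and a `∘₂` basis vector. They span the hyperplane of coefficient sum zero
(`sDiAssNsRel_eq_map`), of dimension `7`. Its orthogonal for the diagonal form is the line of the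
sign vector, which is the associator of `⊢^* + ⊣^*` and hence four times the associator of `*^* =
(⊢^* + ⊣^*)/2` (`nsDualArityThree_inf_orthogonal`).

For the symmetric statement, every element of `F(E^∨)(3)` is a sum of `S₃`-translates of planar
elements, one for each permutation (`symSpan_nsDualArityThree`, `exists_sum_map_of_mem_symSpan`),
and translates by different permutations of the two planar spaces are orthogonal
(`pairing_map_planar`). Orthogonality to the `S₃`-module of relations is therefore tested on each
planar summand separately, which gives `orthogonal_symSpan_sDiAssRelations`.

The Koszul dual is thus presented by `E^∨` and one associator. An `S₂`-equivariant isomorphism `E^∨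
≅ E` with `⊢^* ↦ ≻`, `⊣^* ↦ ≺` turns it into the presentation of `AssAdm`, and functoriality of
`P(E,R)` in the pair `(E,R)` (`operadIso`) finishes the proof. -/

noncomputable section

/-! ### Transport of generated ideals and quotients along isomorphisms of operads. -/

namespace SymmOperad

variable {K : Type u} [Field K]

theorem subset_idealSpan (P : SymmOperad K) {n : ℕ} (S : Set (P.obj (Fin n))) :
    S ⊆ (P.idealSpan n S).carrier (Fin n) := by
  intro x hx
  simp only [idealSpan, SetLike.mem_coe, Submodule.mem_sInf]
  rintro _ ⟨A, hA, rfl⟩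
  exact hA hx

namespace Iso

variable {P Q : SymmOperad K}

/-- The inverse of an isomorphism of operads. -/
def symm (φ : Iso P Q) : Iso Q P where
  equiv I _ := (φ.equiv I).symm
  equiv_map {I J} _ _ e q := by
    rw [LinearEquiv.symm_apply_eq, φ.equiv_map, LinearEquiv.apply_symm_apply]
  equiv_one := by rw [LinearEquiv.symm_apply_eq, φ.equiv_one]
  equiv_circ {I J} _ _ p q := by
    rw [LinearEquiv.symm_apply_eq, φ.equiv_circ, LinearEquiv.apply_symm_apply,
      LinearEquiv.apply_symm_apply]

/-- The preimage of an operadic ideal under an isomorphism. -/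
def comapIdeal (φ : Iso P Q) (B : Q.OperadIdeal) : P.OperadIdeal where
  carrier I _ := (B.carrier I).comap (φ.equiv I).toLinearMap
  map_mem {I J} _ _ e p hp := by
    change φ.equiv J (P.map e p) ∈ B.carrier J
    rw [φ.equiv_map]
    exact B.map_mem e hp
  circ_mem_left {I J} _ _ p q hp := by
    change φ.equiv (I ⊕ J) (P.circ p q) ∈ B.carrier (I ⊕ J)
    rw [φ.equiv_circ]
    exact B.circ_mem_left _ hp
  circ_mem_right {I J} _ _ p q hq := by
    change φ.equiv (I ⊕ J) (P.circ p q) ∈ B.carrier (I ⊕ J)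
    rw [φ.equiv_circ]
    exact B.circ_mem_right _ hq

/-- Minimality of generated ideals, used twice: the preimage under `φ` of the ideal of `T` is an
ideal containing `S`, and symmetrically for `φ.symm`. A check on generators in one arity thus
settles all arities. -/
theorem map_idealSpan_eq (φ : Iso P Q) {n : ℕ} {S : Set (P.obj (Fin n))}
    {T : Set (Q.obj (Fin n))}
    (hS : ∀ x ∈ S, φ.equiv (Fin n) x ∈ (Q.idealSpan n T).carrier (Fin n))
    (hT : ∀ y ∈ T, φ.symm.equiv (Fin n) y ∈ (P.idealSpan n S).carrier (Fin n))
    (I : Type) [Finite I] :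
    ((P.idealSpan n S).carrier I).map (φ.equiv I).toLinearMap = (Q.idealSpan n T).carrier I := by
  apply le_antisymm
  · rw [Submodule.map_le_iff_le_comap]
    exact P.idealSpan_le (φ.comapIdeal (Q.idealSpan n T)) hS I
  · intro y hy
    exact ⟨_, Q.idealSpan_le (φ.symm.comapIdeal (P.idealSpan n S)) hT I hy,
      (φ.equiv I).apply_symm_apply y⟩

/-- The isomorphism of quotient operads induced by an isomorphism that matches the ideals. -/
def quotient (φ : Iso P Q) (A : P.OperadIdeal) (B : Q.OperadIdeal)
    (h : ∀ (I : Type) [Finite I], (A.carrier I).map (φ.equiv I).toLinearMap = B.carrier I) :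
    Iso (P.quotient A) (Q.quotient B) where
  equiv I _ := Submodule.Quotient.equiv (A.carrier I) (B.carrier I) (φ.equiv I) (h I)
  equiv_map {I J} _ _ e p := by
    obtain ⟨p, rfl⟩ := Submodule.mkQ_surjective _ p
    exact congrArg Submodule.Quotient.mk (φ.equiv_map e p)
  equiv_one := congrArg Submodule.Quotient.mk φ.equiv_one
  equiv_circ {I J} _ _ p q := by
    obtain ⟨p, rfl⟩ := Submodule.mkQ_surjective _ p
    obtain ⟨q, rfl⟩ := Submodule.mkQ_surjective _ q
    exact congrArg Submodule.Quotient.mk (φ.equiv_circ p q)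

end Iso

end SymmOperad

/-! ### Functoriality of the tree operad in the set of vertex decorations. -/

namespace BTree

variable {X Y Z : Type u} {I J : Type}

/-- Change of the decorations of the vertices. -/
def mapVertex (f : X → Y) : BTree X I → BTree Y I
  | leaf i => leaf i
  | node x l r => node (f x) (l.mapVertex f) (r.mapVertex f)

theorem mapVertex_mapVertex (f : X → Y) (g : Y → Z) (t : BTree X I) :
    (t.mapVertex f).mapVertex g = t.mapVertex (g ∘ f) := by
  induction t with
  | leaf i => rfl
  | node x l r hl hr => simp [mapVertex, hl, hr]

theorem mapVertex_id (t : BTree X I) : t.mapVertex id = t := by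
  induction t with
  | leaf i => rfl
  | node x l r hl hr => simp [mapVertex, hl, hr]

theorem leaves_mapVertex (f : X → Y) (t : BTree X I) : (t.mapVertex f).leaves = t.leaves := by
  induction t with
  | leaf i => rfl
  | node x l r hl hr => simp [mapVertex, leaves, hl, hr]

theorem mapVertex_bind (f : X → Y) (t : BTree X I) (g : I → BTree X J) :
    (t.bind g).mapVertex f = (t.mapVertex f).bind (fun i => (g i).mapVertex f) := by
  induction t with
  | leaf i => rfl
  | node x l r hl hr => simp [mapVertex, bind, hl, hr]

theorem mapVertex_relabel (f : X → Y) (t : BTree X I) (g : I → J) :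
    (t.relabel g).mapVertex f = (t.mapVertex f).relabel g :=
  mapVertex_bind f t _

theorem mapVertex_graft (f : X → Y) (s : BTree X (Option I)) (t : BTree X J) :
    (s.graft t).mapVertex f = (s.mapVertex f).graft (t.mapVertex f) := by
  rw [graft, mapVertex_bind, graft]
  congr 1
  funext o
  cases o with
  | none => exact mapVertex_relabel f t _
  | some i => rfl

end BTree

namespace MTree

variable {X Y : Type u} {I J : Type}

/-- Change of the decorations of the vertices. -/
def mapVertex (f : X → Y) (t : MTree X I) : MTree Y I :=
  ⟨t.1.mapVertex f, by
    rw [BTree.Multilinear, BTree.leaves_mapVertex]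
    exact t.2⟩

/-- Change of the decorations of the vertices along a bijection. -/
def vertexEquiv (f : X ≃ Y) : MTree X I ≃ MTree Y I where
  toFun := mapVertex f
  invFun := mapVertex f.symm
  left_inv t := Subtype.ext (by
    simp [mapVertex, BTree.mapVertex_mapVertex, BTree.mapVertex_id])
  right_inv t := Subtype.ext (by
    simp [mapVertex, BTree.mapVertex_mapVertex, BTree.mapVertex_id])

end MTree

section TreeIso

variable {K : Type u} [Field K] {X Y : Type u}

/-- A bijection of the generators induces a linear isomorphism of the tree operads. -/
def treeEquiv (K : Type u) [Field K] (f : X ≃ Y) (I : Type) [Finite I] :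
    (treeOperad K X).obj I ≃ₗ[K] (treeOperad K Y).obj I :=
  Finsupp.domLCongr (MTree.vertexEquiv f)

theorem treeEquiv_elt (f : X ≃ Y) {I : Type} [Finite I] (t : MTree X I) :
    treeEquiv K f I (treeElt K t) = treeElt K (t.mapVertex f) :=
  Finsupp.domLCongr_single _ _ _

/-- A bijection of the generators induces an isomorphism of the tree operads. -/
def treeIso (K : Type u) [Field K] (f : X ≃ Y) : SymmOperad.Iso (treeOperad K X) (treeOperad K Y)
    where
  equiv I _ := treeEquiv K f I
  equiv_map {I J} _ _ e p := by
    suffices h : (treeEquiv K f J).toLinearMap ∘ₗ (treeOperad K X).map e =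
        (treeOperad K Y).map e ∘ₗ (treeEquiv K f I).toLinearMap from LinearMap.congr_fun h p
    refine treeElt_hom_ext fun t => ?_
    simp only [LinearMap.comp_apply, LinearEquiv.coe_coe, treeEquiv_elt, map_treeElt]
    exact congrArg _ (Subtype.ext (BTree.mapVertex_relabel _ _ _))
  equiv_one := treeEquiv_elt f MTree.unit
  equiv_circ {I J} _ _ p q := by
    suffices h : (treeOperad K X).circ.compr₂ (treeEquiv K f (I ⊕ J)).toLinearMap =
        (treeOperad K Y).circ.compl₁₂ (treeEquiv K f (Option I)).toLinearMap
          (treeEquiv K f J).toLinearMap from LinearMap.congr_fun₂ h p q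
    refine treeElt_hom_ext fun s => treeElt_hom_ext fun t => ?_
    simp only [LinearMap.compr₂_apply, LinearMap.compl₁₂_apply, LinearEquiv.coe_coe,
      treeEquiv_elt, circ_treeElt]
    exact congrArg _ (Subtype.ext (BTree.mapVertex_graft _ _ _))

end TreeIso

/-! ### Functoriality of `F(E)` in `E` and of `P(E,R)` in `(E,R)`. -/

namespace S2Module

variable {K : Type u} [Field K] {E E' : S2Module K}

/-- Each of the three families goes to the same family: linearity of `f` handles the first two,
equivariance the third. -/
theorem treeIso_mem_linearity (f : E.carrier ≃ₗ[K] E'.carrier)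
    (hf : ∀ e, f (E.swap e) = E'.swap (f e)) {x : (treeOperad K E.carrier).obj (Fin 2)}
    (hx : x ∈ E.linearityRelations) :
    (treeIso K f.toEquiv).equiv (Fin 2) x ∈ E'.linearityRelations := by
  have h (e : E.carrier) :
      (treeIso K f.toEquiv).equiv (Fin 2) (E.preCorolla e) = E'.preCorolla (f e) :=
    treeEquiv_elt _ _
  obtain (⟨e, e', rfl⟩ | ⟨c, e, rfl⟩) | ⟨e, rfl⟩ := hx
  · refine Or.inl (Or.inl ⟨f e, f e', ?_⟩)
    rw [map_sub, map_sub, h, h, h, map_add]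
  · refine Or.inl (Or.inr ⟨c, f e, ?_⟩)
    rw [map_sub, map_smul, h, h, map_smul]
  · refine Or.inr ⟨f e, ?_⟩
    rw [map_sub, (treeIso K f.toEquiv).equiv_map, h, h, hf]

/-- An isomorphism of `S₂`-modules induces an isomorphism of the free operads. -/
def freeIso (f : E.carrier ≃ₗ[K] E'.carrier) (hf : ∀ e, f (E.swap e) = E'.swap (f e)) :
    SymmOperad.Iso E.freeOperad E'.freeOperad :=
  (treeIso K f.toEquiv).quotient _ _ fun I _ =>
    (treeIso K f.toEquiv).map_idealSpan_eq
      (fun _ hx => SymmOperad.subset_idealSpan _ _ (treeIso_mem_linearity f hf hx))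
      (fun _ hx => SymmOperad.subset_idealSpan _ _ (treeIso_mem_linearity f.symm
        (fun e => by rw [LinearEquiv.symm_apply_eq, hf, LinearEquiv.apply_symm_apply]) hx)) I

theorem freeIso_ofTree (f : E.carrier ≃ₗ[K] E'.carrier)
    (hf : ∀ e, f (E.swap e) = E'.swap (f e)) {I : Type} [Finite I] (t : MTree E.carrier I) :
    (freeIso f hf).equiv I (E.ofTree t) = E'.ofTree (t.mapVertex f) :=
  congrArg Submodule.Quotient.mk (treeEquiv_elt f.toEquiv t)

theorem freeIso_associator (f : E.carrier ≃ₗ[K] E'.carrier)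
    (hf : ∀ e, f (E.swap e) = E'.swap (f e)) (μ : E.carrier) :
    (freeIso f hf).equiv (Fin 3) (E.associator μ) = E'.associator (f μ) :=
  (map_sub _ _ _).trans (congrArg₂ _ (freeIso_ofTree f hf _) (freeIso_ofTree f hf _))

theorem freeIso_symSpan (f : E.carrier ≃ₗ[K] E'.carrier)
    (hf : ∀ e, f (E.swap e) = E'.swap (f e)) (S : Set (E.freeOperad.obj (Fin 3))) :
    (E.symSpan S).map ((freeIso f hf).equiv (Fin 3)).toLinearMap =
      E'.symSpan ((freeIso f hf).equiv (Fin 3) '' S) := by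
  rw [symSpan, Submodule.map_span, symSpan]
  congr 1
  ext x
  constructor
  · rintro ⟨_, ⟨σ, s, hs, rfl⟩, rfl⟩
    exact ⟨σ, _, ⟨s, hs, rfl⟩, (freeIso f hf).equiv_map σ s⟩
  · rintro ⟨σ, _, ⟨s, hs, rfl⟩, rfl⟩
    exact ⟨_, ⟨σ, s, hs, rfl⟩, (freeIso f hf).equiv_map σ s⟩

end S2Module

namespace QuadraticData

variable {K : Type u} [Field K]

/-- An isomorphism of the generators that matches the relations induces an isomorphism of binary
quadratic operads. -/
def operadIso (D D' : QuadraticData K) (f : D.gen.carrier ≃ₗ[K] D'.gen.carrier)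
    (hf : ∀ e, f (D.gen.swap e) = D'.gen.swap (f e))
    (h : D.rel.map ((S2Module.freeIso f hf).equiv (Fin 3)).toLinearMap = D'.rel) :
    SymmOperad.Iso D.operad D'.operad :=
  (S2Module.freeIso f hf).quotient _ _ fun I _ =>
    (S2Module.freeIso f hf).map_idealSpan_eq
      (fun x hx => SymmOperad.subset_idealSpan _ _ (h.le ⟨x, hx, rfl⟩))
      (fun y hy => by
        obtain ⟨x, hx, rfl⟩ := h.ge hy
        apply SymmOperad.subset_idealSpan
        change ((S2Module.freeIso f hf).equiv (Fin 3)).symm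
          ((S2Module.freeIso f hf).equiv (Fin 3) x) ∈ D.rel
        rwa [LinearEquiv.symm_apply_apply]) I

theorem operadIso_generator (D D' : QuadraticData K) (f : D.gen.carrier ≃ₗ[K] D'.gen.carrier)
    (hf : ∀ e, f (D.gen.swap e) = D'.gen.swap (f e))
    (h : D.rel.map ((S2Module.freeIso f hf).equiv (Fin 3)).toLinearMap = D'.rel)
    (e : D.gen.carrier) :
    (operadIso D D' f hf h).equiv (Fin 2) (D.generator e) = D'.generator (f e) :=
  congrArg Submodule.Quotient.mk (S2Module.freeIso_ofTree f hf (MTree.corolla e))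

end QuadraticData

/-! ### Bilinearity of composites, and generation of `F(E)(3)` by planar trees. -/

namespace S2Module

variable {K : Type u} [Field K] (E : S2Module K)

theorem circ_ofTree {I J : Type} [Finite I] [Finite J] (s : MTree E.carrier (Option I))
    (t : MTree E.carrier J) :
    E.freeOperad.circ (E.ofTree s) (E.ofTree t) = E.ofTree (s.graft t) :=
  congrArg Submodule.Quotient.mk (circ_treeElt s t)

/-- Turns each family of `linearityRelations` into an identity between corollas in `F(E)(2)`. -/
theorem mk_eq_of_mem_linearity {x y : (treeOperad K E.carrier).obj (Fin 2)}
    (h : x - y ∈ E.linearityRelations) :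
    (Submodule.Quotient.mk x : E.freeOperad.obj (Fin 2)) = Submodule.Quotient.mk y :=
  (Submodule.Quotient.eq _).2 (SymmOperad.subset_idealSpan _ _ h)

theorem corolla_add (e f : E.carrier) : E.corolla (e + f) = E.corolla e + E.corolla f :=
  E.mk_eq_of_mem_linearity (Or.inl (Or.inl ⟨e, f, (sub_sub _ _ _).symm⟩))

theorem corolla_smul (c : K) (e : E.carrier) : E.corolla (c • e) = c • E.corolla e :=
  E.mk_eq_of_mem_linearity (Or.inl (Or.inr ⟨c, e, rfl⟩))

theorem corolla_swap (e : E.carrier) :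
    E.corolla (E.swap e) = E.freeOperad.map (Equiv.swap 0 1) (E.corolla e) :=
  E.mk_eq_of_mem_linearity (Or.inr ⟨e, rfl⟩)

/-- The inclusion of the generators. -/
def corollaLin : E.carrier →ₗ[K] E.freeOperad.obj (Fin 2) where
  toFun := E.corolla
  map_add' := E.corolla_add
  map_smul' := E.corolla_smul

/-- The composite of generators with the inputs relabelled. -/
def composite (d : Fin 2 ≃ Option Unit) (e : Unit ⊕ Fin 2 ≃ Fin 3) :
    E.carrier →ₗ[K] E.carrier →ₗ[K] E.freeOperad.obj (Fin 3) :=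
  (E.freeOperad.circ.compl₁₂ (E.freeOperad.map d ∘ₗ E.corollaLin) E.corollaLin).compr₂
    (E.freeOperad.map e)

theorem composite_apply (d : Fin 2 ≃ Option Unit) (e : Unit ⊕ Fin 2 ≃ Fin 3)
    (μ ν : E.carrier) :
    E.composite d e μ ν =
      E.ofTree ((((MTree.corolla μ).relabel d).graft (MTree.corolla ν)).relabel e) := by
  change E.freeOperad.map e (E.freeOperad.circ (E.freeOperad.map d (E.ofTree _)) (E.ofTree _)) = _
  rw [map_ofTree, circ_ofTree, map_ofTree]

/-- A swapped generator is a relabelled corolla, so the swap can be absorbed into the choice of the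
composition input. -/
theorem composite_swap_left (d : Fin 2 ≃ Option Unit) (e : Unit ⊕ Fin 2 ≃ Fin 3)
    (μ ν : E.carrier) :
    E.composite d e (E.swap μ) ν = E.composite ((Equiv.swap 0 1).trans d) e μ ν := by
  change E.freeOperad.map e (E.freeOperad.circ (E.freeOperad.map d (E.corolla _)) (E.corolla _)) =
    E.freeOperad.map e (E.freeOperad.circ (E.freeOperad.map _ (E.corolla _)) (E.corolla _))
  rw [corolla_swap, SymmOperad.map_trans]

/-- Here the swap acts on the inputs of the inserted operation; `circ_map` carries it out to the
labelling `e`. -/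
theorem composite_swap_right (d : Fin 2 ≃ Option Unit) (e : Unit ⊕ Fin 2 ≃ Fin 3)
    (μ ν : E.carrier) :
    E.composite d e μ (E.swap ν) =
      E.composite d ((Equiv.sumCongr (Equiv.refl _) (Equiv.swap 0 1)).trans e) μ ν := by
  change E.freeOperad.map e (E.freeOperad.circ (E.freeOperad.map d (E.corolla _)) (E.corolla _)) =
    E.freeOperad.map _ (E.freeOperad.circ (E.freeOperad.map _ (E.corolla _)) (E.corolla _))
  rw [corolla_swap, SymmOperad.map_trans, ← SymmOperad.circ_map, Equiv.optionCongr_refl,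
    SymmOperad.map_refl]

theorem map_composite (d : Fin 2 ≃ Option Unit) (e : Unit ⊕ Fin 2 ≃ Fin 3)
    (σ : Equiv.Perm (Fin 3)) (μ ν : E.carrier) :
    E.freeOperad.map σ (E.composite d e μ ν) = E.composite d (e.trans σ) μ ν :=
  (E.freeOperad.map_trans e σ
    (E.freeOperad.circ (E.freeOperad.map d (E.corolla μ)) (E.corolla ν))).symm

/-- The first input of an operation as the composition point. -/
def firstInput : Fin 2 ≃ Option Unit where
  toFun := ![none, some ()]
  invFun o := o.elim 0 fun _ => 1
  left_inv := by decide
  right_inv := by decide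

/-- The labelling of the inputs of `μ(ν(x₁,x₂),x₃)`. -/
def leftLabels : Unit ⊕ Fin 2 ≃ Fin 3 where
  toFun := Sum.elim (fun _ => 2) Fin.castSucc
  invFun := ![Sum.inr 0, Sum.inr 1, Sum.inl ()]
  left_inv := by decide
  right_inv := by decide

/-- The labelling of the inputs of `μ(x₁,ν(x₂,x₃))`. -/
def rightLabels : Unit ⊕ Fin 2 ≃ Fin 3 where
  toFun := Sum.elim (fun _ => 0) Fin.succ
  invFun := ![Sum.inl (), Sum.inr 0, Sum.inr 1]
  left_inv := by decide
  right_inv := by decide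

/-- The linearity relations are imposed in arity two only, so a tree class in arity three is not
visibly bilinear in its decorations. Written through the linear maps `circ`, `map` and `corollaLin`,
it is. -/
theorem circ₁_eq_composite (μ ν : E.carrier) :
    E.circ₁ μ ν = E.composite firstInput leftLabels μ ν := by
  rw [composite_apply]
  rfl

theorem circ₂_eq_composite (μ ν : E.carrier) :
    E.circ₂ μ ν = E.composite ((Equiv.swap 0 1).trans firstInput) rightLabels μ ν := by
  rw [composite_apply]
  exact congrArg E.ofTree (Subtype.ext rfl)

/-- `μ ∘₁ ν` as a bilinear map. -/
def circLin₁ : E.carrier →ₗ[K] E.carrier →ₗ[K] E.freeOperad.obj (Fin 3) :=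
  LinearMap.mk₂ K E.circ₁ (by simp [circ₁_eq_composite]) (by simp [circ₁_eq_composite])
    (by simp [circ₁_eq_composite]) (by simp [circ₁_eq_composite])

/-- `μ ∘₂ ν` as a bilinear map. -/
def circLin₂ : E.carrier →ₗ[K] E.carrier →ₗ[K] E.freeOperad.obj (Fin 3) :=
  LinearMap.mk₂ K E.circ₂ (by simp [circ₂_eq_composite]) (by simp [circ₂_eq_composite])
    (by simp [circ₂_eq_composite]) (by simp [circ₂_eq_composite])

theorem circLin₁_apply (μ ν : E.carrier) : E.circLin₁ μ ν = E.circ₁ μ ν := rfl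

theorem circLin₂_apply (μ ν : E.carrier) : E.circLin₂ μ ν = E.circ₂ μ ν := rfl

/-- `d` only selects the input at which `ν` is inserted, hence `∘₁` or `∘₂`; the labelling `e` then
differs from the standard one by a permutation. -/
theorem exists_map_circ₁_eq_composite (d : Fin 2 ≃ Option Unit) (e : Unit ⊕ Fin 2 ≃ Fin 3)
    (μ ν : E.carrier) : ∃ σ : Equiv.Perm (Fin 3),
      E.composite d e μ ν = E.freeOperad.map σ (E.circ₁ μ ν) ∨
      E.composite d e μ ν = E.freeOperad.map σ (E.circ₂ μ ν) := by
  have hd : d = firstInput ∨ d = (Equiv.swap 0 1).trans firstInput := by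
    revert d
    decide
  obtain rfl | rfl := hd
  · refine ⟨leftLabels.symm.trans e, Or.inl ?_⟩
    rw [circ₁_eq_composite, map_composite, ← Equiv.trans_assoc, Equiv.self_trans_symm,
      Equiv.refl_trans]
  · refine ⟨rightLabels.symm.trans e, Or.inr ?_⟩
    rw [circ₂_eq_composite, map_composite, ← Equiv.trans_assoc, Equiv.self_trans_symm,
      Equiv.refl_trans]

/-- Bilinear expansion gives four terms. Their swaps are absorbed into the labellings, which leaves
relabelled composites of elements of `W`. -/
theorem composite_mem_symSpan {W : Set E.carrier} (hW : ∀ e, ∃ a ∈ W, ∃ b ∈ W, e = a + E.swap b)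
    (d : Fin 2 ≃ Option Unit) (e : Unit ⊕ Fin 2 ≃ Fin 3) (μ ν : E.carrier) :
    E.composite d e μ ν ∈ E.symSpan (E.planarSpan W) := by
  have key (d : Fin 2 ≃ Option Unit) (e : Unit ⊕ Fin 2 ≃ Fin 3) {a b : E.carrier} (ha : a ∈ W)
      (hb : b ∈ W) : E.composite d e a b ∈ E.symSpan (E.planarSpan W) := by
    obtain ⟨σ, h | h⟩ := E.exists_map_circ₁_eq_composite d e a b
    · exact Submodule.subset_span
        ⟨σ, _, Submodule.subset_span ⟨a, ha, b, hb, Or.inl rfl⟩, h⟩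
    · exact Submodule.subset_span
        ⟨σ, _, Submodule.subset_span ⟨a, ha, b, hb, Or.inr rfl⟩, h⟩
  obtain ⟨a, ha, b, hb, rfl⟩ := hW μ
  obtain ⟨a', ha', b', hb', rfl⟩ := hW ν
  simp only [map_add, LinearMap.add_apply, composite_swap_left, composite_swap_right]
  exact add_mem (add_mem (key _ _ ha ha') (key _ _ hb ha'))
    (add_mem (key _ _ ha hb') (key _ _ hb hb'))

/-- A tree with three leaves is a planar tree with relabelled leaves. -/
theorem exists_ofTree_eq_map (t : MTree E.carrier (Fin 3)) :
    ∃ (σ : Equiv.Perm (Fin 3)) (μ ν : E.carrier),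
      E.ofTree t = E.freeOperad.map σ (E.circ₁ μ ν) ∨
      E.ofTree t = E.freeOperad.map σ (E.circ₂ μ ν) := by
  have hσ : ∀ a b c : Fin 3, a ≠ b → a ≠ c → b ≠ c →
      ∃ σ : Equiv.Perm (Fin 3), σ 0 = a ∧ σ 1 = b ∧ σ 2 = c := by decide
  obtain ⟨t, ht⟩ := t
  obtain ⟨x, y, a, b, c, hab, hac, hbc, rfl | rfl⟩ := ht.cases_three
  · obtain ⟨σ, rfl, rfl, rfl⟩ := hσ a b c hab hac hbc
    exact ⟨σ, x, y, Or.inl (E.map_ofTree σ (MTree.left x y)).symm⟩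
  · obtain ⟨σ, rfl, rfl, rfl⟩ := hσ c a b hac.symm hbc.symm hab
    exact ⟨σ, x, y, Or.inr (E.map_ofTree σ (MTree.right x y)).symm⟩

theorem symSpan_planarSpan_eq_top {W : Set E.carrier}
    (hW : ∀ e, ∃ a ∈ W, ∃ b ∈ W, e = a + E.swap b) :
    E.symSpan (E.planarSpan W) = ⊤ := by
  -- Vanishing of the projection to the quotient can be tested on trees.
  suffices h : (E.symSpan (E.planarSpan W)).mkQ = 0 by
    rw [← Submodule.ker_mkQ (E.symSpan (E.planarSpan W)), h, LinearMap.ker_zero]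
  refine E.ofTree_hom_ext fun t => ?_
  rw [LinearMap.zero_apply, Submodule.mkQ_apply, Submodule.Quotient.mk_eq_zero]
  obtain ⟨σ, μ, ν, h | h⟩ := E.exists_ofTree_eq_map t
  · rw [h, circ₁_eq_composite, map_composite]
    exact E.composite_mem_symSpan hW _ _ _ _
  · rw [h, circ₂_eq_composite, map_composite]
    exact E.composite_mem_symSpan hW _ _ _ _

/-- Since `P` is a submodule, all terms translated by the same permutation merge into one. Having
one summand per permutation lets the pairing isolate it later. -/
theorem exists_sum_map_of_mem_symSpan (P : Submodule K (E.freeOperad.obj (Fin 3)))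
    {x : E.freeOperad.obj (Fin 3)} (hx : x ∈ E.symSpan P) :
    ∃ y : Equiv.Perm (Fin 3) → E.freeOperad.obj (Fin 3),
      (∀ σ, y σ ∈ P) ∧ x = ∑ σ, E.freeOperad.map σ (y σ) := by
  induction hx using Submodule.span_induction with
  | mem x hx =>
    obtain ⟨σ, s, hs, rfl⟩ := hx
    refine ⟨Pi.single σ s, fun τ => ?_, ?_⟩
    · obtain rfl | h := eq_or_ne τ σ
      · rwa [Pi.single_eq_same]
      · rw [Pi.single_eq_of_ne h]
        exact zero_mem P
    · rw [Finset.sum_eq_single σ, Pi.single_eq_same]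
      · intro τ _ h
        rw [Pi.single_eq_of_ne h, map_zero]
      · simp
  | zero => exact ⟨0, fun _ => zero_mem P, by simp⟩
  | add x y _ _ hx hy =>
    obtain ⟨a, ha, rfl⟩ := hx
    obtain ⟨b, hb, rfl⟩ := hy
    exact ⟨a + b, fun σ => add_mem (ha σ) (hb σ), by simp [Finset.sum_add_distrib]⟩
  | smul k x _ hx =>
    obtain ⟨a, ha, rfl⟩ := hx
    exact ⟨k • a, fun σ => P.smul_mem k (ha σ), by simp [Finset.smul_sum]⟩

end S2Module

/-! ### Coordinates on the planar composites of two operations. -/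

namespace S2Module

variable {K : Type u} [Field K] (E : S2Module K)

theorem associator_smul (c : K) (μ : E.carrier) :
    E.associator (c • μ) = (c * c) • E.associator μ := by
  simp only [associator, ← circLin₁_apply, ← circLin₂_apply, map_smul, LinearMap.smul_apply,
    smul_smul, smul_sub]

/-- The planar composites of two operations: `(0, i, j)` stands for `b i ∘₁ b j` and `(1, i, j)` for
`b i ∘₂ b j`. -/
def planarFamily (b : Fin 2 → E.carrier) (p : Fin 2 × Fin 2 × Fin 2) : E.freeOperad.obj (Fin 3) :=
  if p.1 = 0 then E.circ₁ (b p.2.1) (b p.2.2) else E.circ₂ (b p.2.1) (b p.2.2)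

/-- The linear combinations of the planar composites of two operations. -/
def planarLin (b : Fin 2 → E.carrier) :
    (Fin 2 × Fin 2 × Fin 2 → K) →ₗ[K] E.freeOperad.obj (Fin 3) :=
  Fintype.linearCombination K (E.planarFamily b)

theorem planarLin_apply (b : Fin 2 → E.carrier) (f : Fin 2 × Fin 2 × Fin 2 → K) :
    E.planarLin b f = ∑ p, f p • E.planarFamily b p :=
  Fintype.linearCombination_apply K _ f

theorem planarLin_single (b : Fin 2 → E.carrier) (p : Fin 2 × Fin 2 × Fin 2) :
    E.planarLin b (Pi.single p 1) = E.planarFamily b p := by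
  rw [planarLin, Fintype.linearCombination_apply_single, one_smul]

theorem range_planarLin (b : Fin 2 → E.carrier) :
    LinearMap.range (E.planarLin b) = Submodule.span K (Set.range (E.planarFamily b)) :=
  Fintype.range_linearCombination K _

theorem planarSpan_eq_range_planarLin {b : Fin 2 → E.carrier} {W : Set E.carrier}
    (hb : ∀ i, b i ∈ W) (hW : ∀ e ∈ W, ∃ c : Fin 2 → K, e = ∑ i, c i • b i) :
    E.planarSpan W = LinearMap.range (E.planarLin b) := by
  rw [range_planarLin]
  apply le_antisymm <;> refine Submodule.span_le.2 ?_
  · have h₁ (i j) : E.circ₁ (b i) (b j) ∈ Submodule.span K (Set.range (E.planarFamily b)) :=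
      Submodule.subset_span ⟨(0, i, j), if_pos rfl⟩
    have h₂ (i j) : E.circ₂ (b i) (b j) ∈ Submodule.span K (Set.range (E.planarFamily b)) :=
      Submodule.subset_span ⟨(1, i, j), if_neg one_ne_zero⟩
    rintro _ ⟨μ, hμ, ν, hν, h⟩
    obtain ⟨c, rfl⟩ := hW μ hμ
    obtain ⟨d, rfl⟩ := hW ν hν
    obtain rfl | rfl := h
    · simp only [← circLin₁_apply, map_sum, map_smul, LinearMap.sum_apply, LinearMap.smul_apply]
      exact sum_mem fun i _ => Submodule.smul_mem _ _ (sum_mem fun j _ =>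
        Submodule.smul_mem _ _ (h₁ _ _))
    · simp only [← circLin₂_apply, map_sum, map_smul, LinearMap.sum_apply, LinearMap.smul_apply]
      exact sum_mem fun i _ => Submodule.smul_mem _ _ (sum_mem fun j _ =>
        Submodule.smul_mem _ _ (h₂ _ _))
  · rintro _ ⟨⟨s, i, j⟩, rfl⟩
    refine Submodule.subset_span ⟨b i, hb i, b j, hb j, ?_⟩
    rw [planarFamily]
    split_ifs
    exacts [Or.inl rfl, Or.inr rfl]

end S2Module

/-! ### The pairing on planar composites and their translates. -/

section

variable {K : Type u} [Field K]

theorem asDual_nsDualOp_nsOp (α : Module.Dual K (K × K)) (v : K × K) :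
    (twoOps K).asDual (nsDualOp K α) (nsOp K v) = α v := rfl

theorem asDual_nsDualOp_swap_nsOp (α : Module.Dual K (K × K)) (v : K × K) :
    (twoOps K).asDual (nsDualOp K α) ((twoOps K).swap (nsOp K v)) = 0 := map_zero α

/-- The translate lies in the copy `σ 2`, the planar tree in the copy `2`. If these agree and `σ ≠
1`, then `σ` exchanges the inner leaves, so `β` enters swapped and vanishes on `w`. -/
theorem pairing_map_circ₁_circ₁ {σ : Equiv.Perm (Fin 3)} (hσ : σ ≠ 1)
    (α β : Module.Dual K (K × K)) (v w : K × K) :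
    (twoOps K).pairing ((twoOps K).signDual.freeOperad.map σ
      ((twoOps K).signDual.circ₁ (nsDualOp K α) (nsDualOp K β)))
      ((twoOps K).circ₁ (nsOp K v) (nsOp K w)) = 0 := by
  have h : σ 2 = 2 → σ 1 ≠ σ 0 + 1 := by revert σ; decide
  rw [S2Module.circ₁, S2Module.circ₁, S2Module.map_ofTree, S2Module.pairing_apply]
  refine Finset.sum_eq_zero fun u _ => ?_
  simp only [S2Module.coord_ofTree, MTree.relabel, MTree.left, BTree.relabel, BTree.bind,
    S2Module.treeCoord]
  by_cases hu : u = 2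
  · by_cases h2 : σ 2 = 2
    · simp [hu, h2, h h2, S2Module.dualEval_tmul, S2Module.asDual_swap,
        asDual_nsDualOp_swap_nsOp]
    · rw [Pi.single_eq_of_ne (by rw [hu]; exact Ne.symm h2)]
      simp
  · rw [Pi.single_eq_of_ne (M := fun _ => (twoOps K).carrier ⊗[K] (twoOps K).carrier) hu]
    simp

/-- The coordinate of a `∘₂` composite has a swapped root, on which `α` vanishes. This is
independent of `σ`, the identity included. -/
theorem pairing_map_circ₁_circ₂ (σ : Equiv.Perm (Fin 3))
    (α β : Module.Dual K (K × K)) (v w : K × K) :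
    (twoOps K).pairing ((twoOps K).signDual.freeOperad.map σ
      ((twoOps K).signDual.circ₁ (nsDualOp K α) (nsDualOp K β)))
      ((twoOps K).circ₂ (nsOp K v) (nsOp K w)) = 0 := by
  rw [S2Module.circ₁, S2Module.circ₂, S2Module.map_ofTree, S2Module.pairing_apply]
  refine Finset.sum_eq_zero fun u _ => ?_
  simp only [S2Module.coord_ofTree, MTree.relabel, MTree.left, MTree.right, BTree.relabel,
    BTree.bind, S2Module.treeCoord]
  by_cases hu : u = 0
  · by_cases h2 : σ 2 = 0
    · simp [hu, h2, S2Module.dualEval_tmul, asDual_nsDualOp_swap_nsOp]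
    · rw [Pi.single_eq_of_ne (by rw [hu]; exact Ne.symm h2)]
      simp
  · rw [Pi.single_eq_of_ne (M := fun _ => (twoOps K).carrier ⊗[K] (twoOps K).carrier) hu]
    simp

/-- Now the functional at the root is swapped, and it vanishes on the unswapped operation `v`. -/
theorem pairing_map_circ₂_circ₁ (σ : Equiv.Perm (Fin 3))
    (α β : Module.Dual K (K × K)) (v w : K × K) :
    (twoOps K).pairing ((twoOps K).signDual.freeOperad.map σ
      ((twoOps K).signDual.circ₂ (nsDualOp K α) (nsDualOp K β)))
      ((twoOps K).circ₁ (nsOp K v) (nsOp K w)) = 0 := by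
  rw [S2Module.circ₁, S2Module.circ₂, S2Module.map_ofTree, S2Module.pairing_apply]
  refine Finset.sum_eq_zero fun u _ => ?_
  simp only [S2Module.coord_ofTree, MTree.relabel, MTree.left, MTree.right, BTree.relabel,
    BTree.bind, S2Module.treeCoord]
  by_cases hu : u = 2
  · by_cases h2 : σ 0 = 2
    · simp [hu, h2, S2Module.dualEval_tmul, S2Module.asDual_swap, asDual_nsDualOp_swap_nsOp]
    · rw [Pi.single_eq_of_ne (by rw [hu]; exact Ne.symm h2)]
      simp
  · rw [Pi.single_eq_of_ne (M := fun _ => (twoOps K).carrier ⊗[K] (twoOps K).carrier) hu]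
    simp

/-- Both roots are swapped, so only the inner vertex can force vanishing: if `σ ≠ 1` fixes `0`, it
exchanges the inner leaves. -/
theorem pairing_map_circ₂_circ₂ {σ : Equiv.Perm (Fin 3)} (hσ : σ ≠ 1)
    (α β : Module.Dual K (K × K)) (v w : K × K) :
    (twoOps K).pairing ((twoOps K).signDual.freeOperad.map σ
      ((twoOps K).signDual.circ₂ (nsDualOp K α) (nsDualOp K β)))
      ((twoOps K).circ₂ (nsOp K v) (nsOp K w)) = 0 := by
  have h : σ 0 = 0 → σ 2 ≠ σ 1 + 1 := by revert σ; decide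
  rw [S2Module.circ₂, S2Module.circ₂, S2Module.map_ofTree, S2Module.pairing_apply]
  refine Finset.sum_eq_zero fun u _ => ?_
  simp only [S2Module.coord_ofTree, MTree.relabel, MTree.right, BTree.relabel, BTree.bind,
    S2Module.treeCoord]
  by_cases hu : u = 0
  · by_cases h2 : σ 0 = 0
    · have h' := h h2
      simp [hu, h2, h', S2Module.dualEval_tmul, S2Module.asDual_swap,
        asDual_nsDualOp_swap_nsOp]
    · rw [Pi.single_eq_of_ne (by rw [hu]; exact Ne.symm h2)]
      simp
  · rw [Pi.single_eq_of_ne (M := fun _ => (twoOps K).carrier ⊗[K] (twoOps K).carrier) hu]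
    simp

theorem pairing_circ₁_circ₁ (α β : Module.Dual K (K × K)) (v w : K × K) :
    (twoOps K).pairing ((twoOps K).signDual.circ₁ (nsDualOp K α) (nsDualOp K β))
      ((twoOps K).circ₁ (nsOp K v) (nsOp K w)) = α v * β w := by
  rw [S2Module.circ₁, S2Module.circ₁, S2Module.pairing_apply, Finset.sum_eq_single 2]
  · simp [S2Module.coord_ofTree, MTree.left, S2Module.treeCoord, S2Module.dualEval_tmul,
      asDual_nsDualOp_nsOp]
  · intro u _ hu
    simp [S2Module.coord_ofTree, MTree.left, S2Module.treeCoord, hu]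
  · simp

/-- Both roots enter swapped. The two swaps cancel, except for the sign built into the swap of
`E^∨`. -/
theorem pairing_circ₂_circ₂ (α β : Module.Dual K (K × K)) (v w : K × K) :
    (twoOps K).pairing ((twoOps K).signDual.circ₂ (nsDualOp K α) (nsDualOp K β))
      ((twoOps K).circ₂ (nsOp K v) (nsOp K w)) = -(α v * β w) := by
  rw [S2Module.circ₂, S2Module.circ₂, S2Module.pairing_apply, Finset.sum_eq_single 0]
  · simp [S2Module.coord_ofTree, MTree.right, S2Module.treeCoord, S2Module.dualEval_tmul,
      S2Module.asDual_swap, S2Module.swap_swap, asDual_nsDualOp_nsOp]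
  · intro u _ hu
    simp [S2Module.coord_ofTree, MTree.right, S2Module.treeCoord, hu]
  · simp

variable (K) in
/-- The two generating operations. -/
def opBasis : Fin 2 → (twoOps K).carrier := ![op₁ K, op₂ K]

variable (K) in
/-- The dual basis of the two generating operations. -/
def dualOpBasis : Fin 2 → (twoOps K).signDual.carrier := ![dualOp₁ K, dualOp₂ K]

theorem opBasis_eq_nsOp (i : Fin 2) :
    opBasis K i = nsOp K (![(1, 0), (0, 1)] i) := by
  fin_cases i <;> rfl

theorem dualOpBasis_eq_nsDualOp (i : Fin 2) :
    dualOpBasis K i = nsDualOp K (![LinearMap.fst K K K, LinearMap.snd K K K] i) := by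
  fin_cases i <;> rfl

theorem nsArityThree_eq_range :
    nsArityThree K = LinearMap.range ((twoOps K).planarLin (opBasis K)) := by
  refine S2Module.planarSpan_eq_range_planarLin _ (fun i => ⟨_, (opBasis_eq_nsOp i).symm⟩) ?_
  rintro _ ⟨v, rfl⟩
  refine ⟨![v.1, v.2], ?_⟩
  rw [Fin.sum_univ_two]
  change ((v.1, v.2), ((0 : K), (0 : K))) =
    ((v.1 * 1 + v.2 * 0, v.1 * 0 + v.2 * 1), (v.1 * 0 + v.2 * 0, v.1 * 0 + v.2 * 0))
  simp

theorem nsDualArityThree_eq_range :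
    nsDualArityThree K =
      LinearMap.range ((twoOps K).signDual.planarLin (dualOpBasis K)) := by
  refine S2Module.planarSpan_eq_range_planarLin _
    (fun i => ⟨_, (dualOpBasis_eq_nsDualOp i).symm⟩) ?_
  rintro _ ⟨α, rfl⟩
  refine ⟨![α (1, 0), α (0, 1)], ?_⟩
  rw [Fin.sum_univ_two]
  refine LinearMap.ext fun e => ?_
  change α (e.1.1, e.1.2) = α (1, 0) * e.1.1 + α (0, 1) * e.1.2
  have h : (e.1.1, e.1.2) = e.1.1 • ((1 : K), (0 : K)) + e.1.2 • ((0 : K), (1 : K)) := by simp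
  rw [h, map_add, map_smul, map_smul]
  simp only [smul_eq_mul, mul_comm]

/-- The sign of a planar composite in the pairing. -/
def planarSign (p : Fin 2 × Fin 2 × Fin 2) : K := if p.1 = 0 then 1 else -1

theorem planarSign_mul_self (p : Fin 2 × Fin 2 × Fin 2) :
    (planarSign p : K) * planarSign p = 1 := by
  rw [planarSign]
  split_ifs <;> simp

theorem pairing_planarFamily (p q : Fin 2 × Fin 2 × Fin 2) :
    (twoOps K).pairing ((twoOps K).signDual.planarFamily (dualOpBasis K) p)
      ((twoOps K).planarFamily (opBasis K) q) = if p = q then planarSign p else 0 := by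
  have h (i j : Fin 2) : ((![LinearMap.fst K K K, LinearMap.snd K K K] i :
      Module.Dual K (K × K))) (![(1, 0), (0, 1)] j) = if i = j then 1 else 0 := by
    fin_cases i <;> fin_cases j <;> simp
  have h₁₂ (α β : Module.Dual K (K × K)) (v w : K × K) :
      (twoOps K).pairing ((twoOps K).signDual.circ₁ (nsDualOp K α) (nsDualOp K β))
      ((twoOps K).circ₂ (nsOp K v) (nsOp K w)) = 0 := by
    simpa only [SymmOperad.map_refl] using pairing_map_circ₁_circ₂ (Equiv.refl _) α β v w
  have h₂₁ (α β : Module.Dual K (K × K)) (v w : K × K) :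
      (twoOps K).pairing ((twoOps K).signDual.circ₂ (nsDualOp K α) (nsDualOp K β))
      ((twoOps K).circ₁ (nsOp K v) (nsOp K w)) = 0 := by
    simpa only [SymmOperad.map_refl] using pairing_map_circ₂_circ₁ (Equiv.refl _) α β v w
  obtain ⟨s, i, j⟩ := p
  obtain ⟨t, k, l⟩ := q
  simp only [S2Module.planarFamily, dualOpBasis_eq_nsDualOp, opBasis_eq_nsOp, planarSign,
    Prod.mk.injEq]
  fin_cases s <;> fin_cases t <;> by_cases hik : i = k <;> by_cases hjl : j = l <;>
    simp [h₁₂, h₂₁, pairing_circ₁_circ₁, pairing_circ₂_circ₂, h, hik, hjl]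

theorem pairing_planarLin (g f : Fin 2 × Fin 2 × Fin 2 → K) :
    (twoOps K).pairing ((twoOps K).signDual.planarLin (dualOpBasis K) g)
      ((twoOps K).planarLin (opBasis K) f) = ∑ p, planarSign p * g p * f p := by
  simp only [S2Module.planarLin_apply, map_sum, map_smul, LinearMap.sum_apply,
    LinearMap.smul_apply, pairing_planarFamily, smul_eq_mul, mul_ite, mul_zero,
    Finset.sum_ite_eq', Finset.mem_univ, if_true]
  exact Finset.sum_congr rfl fun p _ => by ring

/-- This separates the contributions of different permutations and so reduces orthogonality for
symmetric operads to planar trees. -/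
theorem pairing_map_planar {σ : Equiv.Perm (Fin 3)} (hσ : σ ≠ 1)
    {y : (twoOps K).signDual.freeOperad.obj (Fin 3)} (hy : y ∈ nsDualArityThree K)
    {r : (twoOps K).freeOperad.obj (Fin 3)} (hr : r ∈ nsArityThree K) :
    (twoOps K).pairing ((twoOps K).signDual.freeOperad.map σ y) r = 0 := by
  induction hy using Submodule.span_induction with
  | zero => simp
  | add y y' _ _ hy hy' => simp only [map_add, LinearMap.add_apply, hy, hy', add_zero]
  | smul k y _ hy => simp only [map_smul, LinearMap.smul_apply, hy, smul_zero]
  | mem y hy =>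
    induction hr using Submodule.span_induction with
    | zero => simp
    | add r r' _ _ hr hr' => simp only [map_add, hr, hr', add_zero]
    | smul k r _ hr => simp only [map_smul, hr, smul_zero]
    | mem r hr =>
      obtain ⟨_, ⟨α, rfl⟩, _, ⟨β, rfl⟩, rfl | rfl⟩ := hy <;>
        obtain ⟨_, ⟨v, rfl⟩, _, ⟨w, rfl⟩, rfl | rfl⟩ := hr
      · exact pairing_map_circ₁_circ₁ hσ α β v w
      · exact pairing_map_circ₁_circ₂ σ α β v w
      · exact pairing_map_circ₂_circ₁ σ α β v w
      · exact pairing_map_circ₂_circ₂ hσ α β v w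

/-- The pairing with the dual composite indexed by `p` recovers the coefficient `f p` up to sign. -/
theorem planarLin_opBasis_injective :
    Function.Injective ((twoOps K).planarLin (opBasis K)) := by
  rw [injective_iff_map_eq_zero]
  intro f hf
  funext p
  have h := pairing_planarLin (Pi.single p 1) f
  rw [hf, map_zero, Finset.sum_eq_single p (fun q _ hq => by simp [hq]) (by simp),
    Pi.single_eq_same, mul_one] at h
  rw [Pi.zero_apply, ← one_mul (f p), ← planarSign_mul_self (K := K) p, mul_assoc, ← h, mul_zero]

theorem finrank_nsArityThree : Module.finrank K (nsArityThree K) = 8 := by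
  rw [nsArityThree_eq_range, LinearMap.finrank_range_of_inj planarLin_opBasis_injective]
  simp

end

/-- Used to pass from the associator of `dualStar` to that of `dualOp₁ + dualOp₂`. -/
theorem S2Module.symSpan_singleton_smul {K : Type u} [Field K] (E : S2Module K) {c : K}
    (hc : c ≠ 0) (x : E.freeOperad.obj (Fin 3)) : E.symSpan {c • x} = E.symSpan {x} := by
  apply le_antisymm <;> refine Submodule.span_le.2 ?_
  · rintro _ ⟨σ, _, rfl, rfl⟩
    rw [map_smul]
    exact Submodule.smul_mem _ _ (Submodule.subset_span ⟨σ, x, rfl, rfl⟩)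
  · rintro _ ⟨σ, s, hs, rfl⟩
    rw [Set.mem_singleton_iff.1 hs]
    have h : E.freeOperad.map σ (c • x) ∈ E.symSpan {c • x} :=
      Submodule.subset_span ⟨σ, _, rfl, rfl⟩
    rw [map_smul] at h
    exact (Submodule.smul_mem_iff _ hc).1 h

section

variable {K : Type u} [Field K]

/-! ### The relations of symmetric dialgebras -/

variable (K) in
/-- The sum of the coefficients. -/
def coeffSum : (Fin 2 × Fin 2 × Fin 2 → K) →ₗ[K] K := ∑ p, LinearMap.proj p

theorem coeffSum_apply (f : Fin 2 × Fin 2 × Fin 2 → K) : coeffSum K f = ∑ p, f p := by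
  simp [coeffSum]

theorem planarFamily_sub_mem (i j k l : Fin 2) :
    (twoOps K).planarFamily (opBasis K) (0, i, j) - (twoOps K).planarFamily (opBasis K) (1, k, l) ∈
      sDiAssRelations K := by
  have h (i : Fin 2) : opBasis K i ∈ ({op₁ K, op₂ K} : Set (twoOps K).carrier) := by
    fin_cases i
    exacts [Or.inl rfl, Or.inr rfl]
  -- In `(a m₁ b) m₂ c` the operation `m₁` is the inner one, hence the order `j`, `i`.
  exact ⟨_, h j, _, h i, _, h k, _, h l, rfl⟩

theorem exists_planarFamily_sub_of_mem {x : (twoOps K).freeOperad.obj (Fin 3)}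
    (hx : x ∈ sDiAssRelations K) : ∃ i j k l : Fin 2,
      x = (twoOps K).planarFamily (opBasis K) (0, i, j) -
        (twoOps K).planarFamily (opBasis K) (1, k, l) := by
  have h (m) (hm : m ∈ ({op₁ K, op₂ K} : Set (twoOps K).carrier)) : ∃ i, m = opBasis K i := by
    obtain rfl | rfl := hm
    exacts [⟨0, rfl⟩, ⟨1, rfl⟩]
  obtain ⟨m₁, h₁, m₂, h₂, m₃, h₃, m₄, h₄, rfl⟩ := hx
  obtain ⟨j, rfl⟩ := h _ h₁
  obtain ⟨i, rfl⟩ := h _ h₂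
  obtain ⟨k, rfl⟩ := h _ h₃
  obtain ⟨l, rfl⟩ := h _ h₄
  exact ⟨i, j, k, l, rfl⟩

/-- The relations are the edges of the complete bipartite graph between the `∘₁` and the `∘₂` basis
vectors. The graph is connected, so the edge differences span the vectors of coefficient sum zero.
-/
theorem sDiAssNsRel_eq_map :
    sDiAssNsRel K =
      (LinearMap.ker (coeffSum K)).map ((twoOps K).planarLin (opBasis K)) := by
  apply le_antisymm
  · refine Submodule.span_le.2 fun x hx => ?_
    obtain ⟨i, j, k, l, rfl⟩ := exists_planarFamily_sub_of_mem hx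
    refine ⟨Pi.single (0, i, j) 1 - Pi.single (1, k, l) 1, ?_, ?_⟩
    · simp [coeffSum_apply]
    · rw [map_sub, S2Module.planarLin_single, S2Module.planarLin_single]
  · rintro _ ⟨f, hf, rfl⟩
    have hf' : ∑ p, f p = 0 := by rw [← coeffSum_apply]; exact hf
    have h1 (i j k l) : (twoOps K).planarFamily (opBasis K) (0, i, j) -
        (twoOps K).planarFamily (opBasis K) (1, k, l) ∈ sDiAssNsRel K :=
      Submodule.subset_span (planarFamily_sub_mem i j k l)
    have h2 (p) : (twoOps K).planarFamily (opBasis K) p -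
        (twoOps K).planarFamily (opBasis K) (1, 0, 0) ∈ sDiAssNsRel K := by
      obtain ⟨s, i, j⟩ := p
      fin_cases s
      · exact h1 i j 0 0
      -- Two `∘₂` vectors are joined by a path through a common `∘₁` vector.
      · have := sub_mem (h1 0 0 0 0) (h1 0 0 i j)
        rwa [sub_sub_sub_cancel_left] at this
    -- As the coefficients sum to zero, a fixed base vector may be subtracted from every term.
    have h3 : (twoOps K).planarLin (opBasis K) f =
        ∑ p, f p • ((twoOps K).planarFamily (opBasis K) p -
          (twoOps K).planarFamily (opBasis K) (1, 0, 0)) := by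
      simp only [smul_sub, Finset.sum_sub_distrib]
      rw [← Finset.sum_smul, hf', zero_smul, sub_zero, S2Module.planarLin_apply]
    rw [h3]
    exact sum_mem fun p _ => Submodule.smul_mem _ _ (h2 p)

theorem sDiAssNsRel_le : sDiAssNsRel K ≤ nsArityThree K := by
  rw [sDiAssNsRel_eq_map, nsArityThree_eq_range]
  exact LinearMap.map_le_range

theorem finrank_sDiAssNsRel : Module.finrank K (sDiAssNsRel K) = 7 := by
  rw [sDiAssNsRel_eq_map, ← (Submodule.equivMapOfInjective _ planarLin_opBasis_injective
    (LinearMap.ker (coeffSum K))).finrank_eq]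
  have h : coeffSum K ≠ 0 := fun h => by
    have := LinearMap.congr_fun h (Pi.single (0, 0, 0) 1)
    simp [coeffSum_apply] at this
  have := Module.Dual.finrank_ker_add_one_of_ne_zero h
  simp at this
  omega

/-- A uniform form for both operations, with `c = 1` for `⊢` and `c = -1` for `⊣`, so that all
relations are expanded at once. -/
theorem op_eq_of_mem [CharZero K] {m : (twoOps K).carrier}
    (hm : m ∈ ({op₁ K, op₂ K} : Set (twoOps K).carrier)) :
    ∃ c : K, m = (2 : K)⁻¹ • (starOp K + c • wedgeOp K) := by
  obtain rfl | rfl := hm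
  · refine ⟨1, ?_⟩
    rw [starOp, wedgeOp]
    module
  · refine ⟨-1, ?_⟩
    rw [starOp, wedgeOp]
    module

/-- With operations `(* + c ∧)/2`, the part of a relation free of the constants `c` is a quarter of
the associator of `*`; every other term contains `∧`. Conversely each listed element has coefficient
sum zero in the composites of `⊢, ⊣`. -/
theorem sDiAssNsRel_eq_span [CharZero K] :
    sDiAssNsRel K = Submodule.span K
      {(twoOps K).associator (starOp K),
        (twoOps K).circ₁ (wedgeOp K) (starOp K), (twoOps K).circ₂ (wedgeOp K) (starOp K),
        (twoOps K).circ₁ (wedgeOp K) (wedgeOp K), (twoOps K).circ₂ (wedgeOp K) (wedgeOp K),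
        (twoOps K).circ₁ (starOp K) (wedgeOp K), (twoOps K).circ₂ (starOp K) (wedgeOp K)} := by
  apply le_antisymm
  · refine Submodule.span_le.2 ?_
    rintro _ ⟨m₁, h₁, m₂, h₂, m₃, h₃, m₄, h₄, rfl⟩
    obtain ⟨c₁, rfl⟩ := op_eq_of_mem h₁
    obtain ⟨c₂, rfl⟩ := op_eq_of_mem h₂
    obtain ⟨c₃, rfl⟩ := op_eq_of_mem h₃
    obtain ⟨c₄, rfl⟩ := op_eq_of_mem h₄
    set M := Submodule.span K
      {(twoOps K).associator (starOp K),
        (twoOps K).circ₁ (wedgeOp K) (starOp K), (twoOps K).circ₂ (wedgeOp K) (starOp K),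
        (twoOps K).circ₁ (wedgeOp K) (wedgeOp K), (twoOps K).circ₂ (wedgeOp K) (wedgeOp K),
        (twoOps K).circ₁ (starOp K) (wedgeOp K), (twoOps K).circ₂ (starOp K) (wedgeOp K)}
    have e : (twoOps K).circ₁ ((2 : K)⁻¹ • (starOp K + c₂ • wedgeOp K))
          ((2 : K)⁻¹ • (starOp K + c₁ • wedgeOp K)) -
        (twoOps K).circ₂ ((2 : K)⁻¹ • (starOp K + c₃ • wedgeOp K))
          ((2 : K)⁻¹ • (starOp K + c₄ • wedgeOp K)) =
        ((2 : K)⁻¹ * (2 : K)⁻¹) • ((twoOps K).associator (starOp K) +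
          c₂ • (twoOps K).circ₁ (wedgeOp K) (starOp K) +
          -c₃ • (twoOps K).circ₂ (wedgeOp K) (starOp K) +
          (c₂ * c₁) • (twoOps K).circ₁ (wedgeOp K) (wedgeOp K) +
          -(c₃ * c₄) • (twoOps K).circ₂ (wedgeOp K) (wedgeOp K) +
          c₁ • (twoOps K).circ₁ (starOp K) (wedgeOp K) +
          -c₄ • (twoOps K).circ₂ (starOp K) (wedgeOp K)) := by
      simp only [S2Module.associator, ← S2Module.circLin₁_apply, ← S2Module.circLin₂_apply,
        map_add, map_smul, LinearMap.add_apply, LinearMap.smul_apply]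
      module
    rw [SetLike.mem_coe, e]
    refine Submodule.smul_mem _ _ (add_mem (add_mem (add_mem (add_mem (add_mem (add_mem ?_ ?_)
      ?_) ?_) ?_) ?_) ?_)
    · exact Submodule.subset_span (by simp)
    all_goals exact Submodule.smul_mem _ _ (Submodule.subset_span (by simp))
  · refine Submodule.span_le.2 ?_
    -- Two relations with the same `∘₂` term differ by two `∘₁` composites; `h22` is the mirror
    -- image.
    have h11 (i j k l) : (twoOps K).circ₁ (opBasis K i) (opBasis K j) -
        (twoOps K).circ₁ (opBasis K k) (opBasis K l) ∈ sDiAssNsRel K := by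
      have := sub_mem (Submodule.subset_span (R := K) (planarFamily_sub_mem (K := K) i j 0 0))
        (Submodule.subset_span (R := K) (planarFamily_sub_mem (K := K) k l 0 0))
      rwa [sub_sub_sub_cancel_right] at this
    have h22 (i j k l) : (twoOps K).circ₂ (opBasis K i) (opBasis K j) -
        (twoOps K).circ₂ (opBasis K k) (opBasis K l) ∈ sDiAssNsRel K := by
      have := sub_mem (Submodule.subset_span (R := K) (planarFamily_sub_mem (K := K) 0 0 k l))
        (Submodule.subset_span (R := K) (planarFamily_sub_mem (K := K) 0 0 i j))
      rwa [sub_sub_sub_cancel_left] at this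
    have h12 (i j k l) : (twoOps K).circ₁ (opBasis K i) (opBasis K j) -
        (twoOps K).circ₂ (opBasis K k) (opBasis K l) ∈ sDiAssNsRel K :=
      Submodule.subset_span (planarFamily_sub_mem i j k l)
    have hs : starOp K = opBasis K 0 + opBasis K 1 := rfl
    have hw : wedgeOp K = opBasis K 0 - opBasis K 1 := rfl
    simp only [← S2Module.circLin₁_apply, ← S2Module.circLin₂_apply] at h11 h22 h12
    simp only [Set.insert_subset_iff, Set.singleton_subset_iff, SetLike.mem_coe,
      S2Module.associator, ← S2Module.circLin₁_apply, ← S2Module.circLin₂_apply, hs, hw, map_add,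
      map_sub, LinearMap.add_apply, LinearMap.sub_apply]
    refine ⟨?_, ?_, ?_, ?_, ?_, ?_, ?_⟩
    · convert add_mem (add_mem (h12 0 0 0 0) (h12 0 1 0 1)) (add_mem (h12 1 0 1 0) (h12 1 1 1 1))
        using 1
      abel
    · convert add_mem (h11 0 0 1 0) (h11 0 1 1 1) using 1
    · convert add_mem (h22 0 0 1 0) (h22 0 1 1 1) using 1
    · convert sub_mem (h11 0 0 1 0) (h11 0 1 1 1) using 1
    · convert sub_mem (h22 0 0 1 0) (h22 0 1 1 1) using 1
    · convert add_mem (h11 0 0 0 1) (h11 1 0 1 1) using 1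
      abel
    · convert add_mem (h22 0 0 0 1) (h22 1 0 1 1) using 1
      abel

/-! ### The orthogonal complement -/

/-- Expanding the associator of the sum gives every `∘₁` composite with coefficient `1` and every
`∘₂` composite with coefficient `-1`. -/
theorem planarLin_planarSign :
    (twoOps K).signDual.planarLin (dualOpBasis K) planarSign =
      (twoOps K).signDual.associator (dualOp₁ K + dualOp₂ K) := by
  rw [S2Module.planarLin_apply, S2Module.associator, ← S2Module.circLin₁_apply,
    ← S2Module.circLin₂_apply]
  simp only [Fintype.sum_prod_type, Fin.sum_univ_two, S2Module.planarFamily, planarSign,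
    map_add, LinearMap.add_apply, S2Module.circLin₁_apply, S2Module.circLin₂_apply]
  simp [dualOpBasis]
  abel

theorem associator_dualStar :
    (twoOps K).signDual.associator (dualStar K) =
      ((2 : K)⁻¹ * (2 : K)⁻¹) • (twoOps K).signDual.associator (dualOp₁ K + dualOp₂ K) := by
  rw [← S2Module.associator_smul]
  rfl

theorem inv_two_mul_inv_two_ne_zero [CharZero K] : (2 : K)⁻¹ * (2 : K)⁻¹ ≠ 0 :=
  mul_ne_zero (inv_ne_zero two_ne_zero) (inv_ne_zero two_ne_zero)

/-- In coordinates the condition is that `∑ planarSign p * g p * f p` vanishes for all `f` of sum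
zero, that is, `planarSign * g` is constant. -/
theorem nsDualArityThree_inf_orthogonal [CharZero K] :
    nsDualArityThree K ⊓ (twoOps K).orthogonal (sDiAssNsRel K) =
      Submodule.span K {(twoOps K).signDual.associator (dualStar K)} := by
  rw [associator_dualStar, Submodule.span_singleton_smul_eq
    (IsUnit.mk0 _ inv_two_mul_inv_two_ne_zero), ← planarLin_planarSign, nsDualArityThree_eq_range,
    sDiAssNsRel_eq_map]
  apply le_antisymm
  · rintro _ ⟨⟨g, rfl⟩, hg⟩
    have h (p) : g p = g (0, 0, 0) * planarSign p := by
      -- This sum-zero vector compares the coordinate `p` with the base coordinate.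
      have h := hg _ ⟨Pi.single p 1 - Pi.single (0, 0, 0) 1, by simp [coeffSum_apply], rfl⟩
      rw [pairing_planarLin] at h
      simp only [Pi.sub_apply, mul_sub, Finset.sum_sub_distrib, Pi.single_apply, mul_ite, mul_one,
        mul_zero, Finset.sum_ite_eq', Finset.mem_univ, if_true] at h
      have h0 : (planarSign (0, 0, 0) : K) = 1 := if_pos rfl
      rw [h0] at h
      linear_combination (planarSign p : K) * h - g p * planarSign_mul_self (K := K) p
    rw [show g = g (0, 0, 0) • planarSign from funext h, map_smul]
    exact Submodule.smul_mem _ _ (Submodule.mem_span_singleton_self _)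
  · rw [Submodule.span_singleton_le_iff_mem]
    refine ⟨⟨_, rfl⟩, ?_⟩
    rintro _ ⟨f, hf, rfl⟩
    rw [pairing_planarLin]
    simp only [planarSign_mul_self, one_mul]
    rw [← coeffSum_apply]
    exact hf

theorem associator_dualStar_ne_zero [CharZero K] :
    (twoOps K).signDual.associator (dualStar K) ≠ 0 := by
  rw [associator_dualStar, ← planarLin_planarSign]
  refine smul_ne_zero inv_two_mul_inv_two_ne_zero fun h => ?_
  -- The associator of `⊢^* + ⊣^*` pairs to `1` with `⊢ ∘₁ ⊢`.
  have h' := pairing_planarLin (K := K) planarSign (Pi.single (0, 0, 0) 1)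
  simp only [planarSign_mul_self, one_mul, h, map_zero, LinearMap.zero_apply] at h'
  simp at h'

theorem pairing_map_right (σ : Equiv.Perm (Fin 3))
    (x : (twoOps K).signDual.freeOperad.obj (Fin 3)) (y : (twoOps K).freeOperad.obj (Fin 3)) :
    (twoOps K).pairing x ((twoOps K).freeOperad.map σ y) = ((Equiv.Perm.sign σ : ℤ) : K) *
      (twoOps K).pairing ((twoOps K).signDual.freeOperad.map σ.symm x) y := by
  rw [← S2Module.pairing_map, ← SymmOperad.map_trans, Equiv.symm_trans_self, SymmOperad.map_refl]

theorem symSpan_nsDualArityThree :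
    (twoOps K).signDual.symSpan (nsDualArityThree K) = ⊤ := by
  refine S2Module.symSpan_planarSpan_eq_top _ fun α => ?_
  -- A functional splits into its restrictions to `V` and to the opposite operations. The second
  -- carries a minus sign, which cancels the one in the swap of `E^∨`.
  refine ⟨_, ⟨(twoOps K).asDual α ∘ₗ LinearMap.inl K _ _, rfl⟩, _,
    ⟨-((twoOps K).asDual α ∘ₗ LinearMap.inr K _ _), rfl⟩, ?_⟩
  refine LinearMap.ext fun e => ?_
  change (twoOps K).asDual α e = (twoOps K).asDual α (e.1, 0) +
    - -(twoOps K).asDual α ((0 : K × K), e.2)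
  rw [neg_neg]
  refine Eq.trans ?_ (map_add ((twoOps K).asDual α) _ _)
  exact congrArg _ (Prod.ext (add_zero _).symm (zero_add _).symm)

/-- For `x = ∑ σ y_σ` with planar `y_σ`, the pairing with `σ r`, where `r` is a planar relation,
sees only the summand of `σ`. So every `y_σ` lies on the line of the associator. Conversely the
orthogonal is `S₃`-stable, so only the untranslated associator has to be tested against translated
relations. -/
theorem orthogonal_symSpan_sDiAssRelations [CharZero K] :
    (twoOps K).orthogonal ((twoOps K).symSpan (sDiAssRelations K)) =
      (twoOps K).signDual.symSpan {(twoOps K).signDual.associator (dualStar K)} := by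
  apply le_antisymm
  · intro x hx
    have hx' : x ∈ (twoOps K).signDual.symSpan (nsDualArityThree K) := by
      rw [symSpan_nsDualArityThree]
      trivial
    obtain ⟨y, hy, rfl⟩ := S2Module.exists_sum_map_of_mem_symSpan _ _ hx'
    refine sum_mem fun σ _ => S2Module.map_mem_symSpan _ _ ?_
    have h : y σ ∈ nsDualArityThree K ⊓ (twoOps K).orthogonal (sDiAssNsRel K) := by
      refine ⟨hy σ, fun r hr => ?_⟩
      have hr' : (twoOps K).freeOperad.map σ r ∈ (twoOps K).symSpan (sDiAssRelations K) := by
        refine S2Module.map_mem_symSpan _ _ (Submodule.span_mono ?_ hr)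
        exact fun s hs => ⟨1, s, hs, (SymmOperad.map_refl _ _).symm⟩
      have h := hx _ hr'
      rw [map_sum, LinearMap.sum_apply, Finset.sum_eq_single σ] at h
      · rw [S2Module.pairing_map] at h
        refine (mul_eq_zero.1 h).resolve_left ?_
        obtain h | h := Int.units_eq_one_or (Equiv.Perm.sign σ) <;> simp [h]
      -- Moving `σ` across the pairing leaves the translate of `y τ` by `σ⁻¹τ ≠ 1`, which is
      -- orthogonal to planar elements.
      · intro τ _ hτ
        rw [pairing_map_right, ← SymmOperad.map_trans, pairing_map_planar _ (hy τ)
          (sDiAssNsRel_le hr), mul_zero]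
        intro h
        refine hτ (Equiv.ext fun i => ?_)
        have := Equiv.congr_fun h i
        exact (Equiv.symm_apply_eq σ).1 this
      · simp
    rw [nsDualArityThree_inf_orthogonal] at h
    refine Submodule.span_mono ?_ h
    exact fun s hs => ⟨1, s, hs, (SymmOperad.map_refl _ _).symm⟩
  · refine Submodule.span_le.2 ?_
    rintro _ ⟨σ, _, rfl, rfl⟩
    refine (sDiAss K).koszulDual.map_mem_rel σ _ fun r hr => ?_
    have ha : (twoOps K).signDual.associator (dualStar K) ∈
        nsDualArityThree K ⊓ (twoOps K).orthogonal (sDiAssNsRel K) := by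
      rw [nsDualArityThree_inf_orthogonal]
      exact Submodule.mem_span_singleton_self _
    induction hr using Submodule.span_induction with
    | zero => exact map_zero _
    | add r r' _ _ h h' => exact (map_add _ _ _).trans (by rw [h, h', add_zero])
    | smul k r _ h => exact (map_smul _ _ _).trans (by rw [h, smul_zero])
    | mem r hr =>
      obtain ⟨τ, s, hs, rfl⟩ := hr
      have hs' : s ∈ sDiAssNsRel K := Submodule.subset_span hs
      refine (pairing_map_right τ _ s).trans (mul_eq_zero_of_right _ ?_)
      -- The identity translate is the planar computation; all others vanish by
      -- `pairing_map_planar`.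
      obtain rfl | hτ := eq_or_ne τ 1
      · exact (congrArg ((twoOps K).pairing · s) (SymmOperad.map_refl _ _)).trans (ha.2 s hs')
      · exact pairing_map_planar (fun h => hτ (inv_eq_one.1 h)) ha.1 (sDiAssNsRel_le hs')

/-! ### The Koszul dual -/

variable (K) in
/-- The identification of the generators of the Koszul dual with those of ass.-admissible
algebras. -/
def dualOpsEquiv : (twoOps K).signDual.carrier ≃ₗ[K] (twoOps K).carrier where
  -- The minus signs on the opposite operations make the map equivariant: the swap of `E^∨` is minus
  -- the transpose of the exchange.
  toFun α := (((twoOps K).asDual α ((1, 0), 0), (twoOps K).asDual α ((0, 1), 0)),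
    (-(twoOps K).asDual α (0, (1, 0)), -(twoOps K).asDual α (0, (0, 1))))
  map_add' α β := Prod.ext rfl (Prod.ext (neg_add _ _) (neg_add _ _))
  map_smul' c α := Prod.ext rfl (Prod.ext (mul_neg _ _).symm (mul_neg _ _).symm)
  invFun v := v.1.1 • dualOp₁ K + v.1.2 • dualOp₂ K +
    (twoOps K).signDual.swap (v.2.1 • dualOp₁ K + v.2.2 • dualOp₂ K)
  left_inv α := by
    refine LinearMap.ext fun e => ?_
    have he : e = e.1.1 • (((1, 0), 0) : (K × K) × (K × K)) + e.1.2 • ((0, 1), 0) +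
        e.2.1 • (0, (1, 0)) + e.2.2 • (0, (0, 1)) := by
      change ((e.1.1, e.1.2), (e.2.1, e.2.2)) =
        ((e.1.1 * 1 + e.1.2 * 0 + e.2.1 * 0 + e.2.2 * 0,
          e.1.1 * 0 + e.1.2 * 1 + e.2.1 * 0 + e.2.2 * 0),
        (e.1.1 * 0 + e.1.2 * 0 + e.2.1 * 1 + e.2.2 * 0,
          e.1.1 * 0 + e.1.2 * 0 + e.2.1 * 0 + e.2.2 * 1))
      simp
    change (twoOps K).asDual α ((1, 0), 0) * e.1.1 + (twoOps K).asDual α ((0, 1), 0) * e.1.2 +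
      -(-(twoOps K).asDual α (0, (1, 0)) * e.2.1 + -(twoOps K).asDual α (0, (0, 1)) * e.2.2) =
      (twoOps K).asDual α e
    refine Eq.trans ?_ (congrArg ((twoOps K).asDual α) he).symm
    refine Eq.trans ?_ ((map_add _ _ _).trans (congrArg₂ _ ((map_add _ _ _).trans (congrArg₂ _
      ((map_add _ _ _).trans (congrArg₂ _ (map_smul _ _ _) (map_smul _ _ _)))
      (map_smul _ _ _))) (map_smul _ _ _))).symm
    simp only [smul_eq_mul]
    ring
  right_inv v := by
    change ((v.1.1 * 1 + v.1.2 * 0 + -(v.2.1 * 0 + v.2.2 * 0),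
        v.1.1 * 0 + v.1.2 * 1 + -(v.2.1 * 0 + v.2.2 * 0)),
      (-(v.1.1 * 0 + v.1.2 * 0 + -(v.2.1 * 1 + v.2.2 * 0)),
        -(v.1.1 * 0 + v.1.2 * 0 + -(v.2.1 * 0 + v.2.2 * 1)))) = v
    refine Prod.ext (Prod.ext ?_ ?_) (Prod.ext ?_ ?_) <;> simp

theorem dualOpsEquiv_swap (α : (twoOps K).signDual.carrier) :
    dualOpsEquiv K ((twoOps K).signDual.swap α) = (twoOps K).swap (dualOpsEquiv K α) :=
  Prod.ext rfl (Prod.ext (neg_neg _) (neg_neg _))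

theorem dualOpsEquiv_dualOp₁ : dualOpsEquiv K (dualOp₁ K) = op₁ K :=
  Prod.ext rfl (Prod.ext neg_zero neg_zero)

theorem dualOpsEquiv_dualOp₂ : dualOpsEquiv K (dualOp₂ K) = op₂ K :=
  Prod.ext rfl (Prod.ext neg_zero neg_zero)

/-- Up to the nonzero scalar `1/4` the dual relation is the associator of `dualOp₁ + dualOp₂`, whose
image is the defining relation of `AssAdm`. -/
theorem map_koszulDual_rel [CharZero K] :
    (sDiAss K).koszulDual.rel.map ((S2Module.freeIso (dualOpsEquiv K)
      dualOpsEquiv_swap).equiv (Fin 3)).toLinearMap = (AssAdm K).rel := by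
  have h : (sDiAss K).koszulDual.rel =
      (twoOps K).signDual.symSpan
        {(twoOps K).signDual.associator (dualOp₁ K + dualOp₂ K)} := by
    refine orthogonal_symSpan_sDiAssRelations.trans ?_
    rw [associator_dualStar, S2Module.symSpan_singleton_smul _ inv_two_mul_inv_two_ne_zero]
  refine (congrArg (Submodule.map _) h).trans ((S2Module.freeIso_symSpan _ _ _).trans ?_)
  rw [Set.image_singleton, S2Module.freeIso_associator, map_add, dualOpsEquiv_dualOp₁,
    dualOpsEquiv_dualOp₂]
  rfl

end

end

/-! ### The Koszul dual of symmetric dialgebras, assembled. -/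

theorem mainTheorem5 (K : Type u) [Field K] [CharZero K] :
    -- the Koszul dual operad of `sDiAss` is `AssAdm`, with `⊢^* ↦ ≻` and `⊣^* ↦ ≺`
    (∃ φ : SymmOperad.Iso (sDiAss K).koszulDual.operad (AssAdm K).operad,
      φ.equiv (Fin 2) ((sDiAss K).koszulDual.generator (dualOp₁ K)) =
        (AssAdm K).generator (op₁ K) ∧
      φ.equiv (Fin 2) ((sDiAss K).koszulDual.generator (dualOp₂ K)) =
        (AssAdm K).generator (op₂ K)) ∧
    -- the space of nonsymmetric compositions of arity three and its relation space
    Module.finrank K (nsArityThree K) = 8 ∧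
    sDiAssNsRel K ≤ nsArityThree K ∧
    Module.finrank K (sDiAssNsRel K) = 7 ∧
    sDiAssNsRel K = Submodule.span K
      {(twoOps K).associator (starOp K),
        (twoOps K).circ₁ (wedgeOp K) (starOp K), (twoOps K).circ₂ (wedgeOp K) (starOp K),
        (twoOps K).circ₁ (wedgeOp K) (wedgeOp K), (twoOps K).circ₂ (wedgeOp K) (wedgeOp K),
        (twoOps K).circ₁ (starOp K) (wedgeOp K), (twoOps K).circ₂ (starOp K) (wedgeOp K)} ∧
    -- the orthogonal complement of the relation space
    nsDualArityThree K ⊓ (twoOps K).orthogonal (sDiAssNsRel K) =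
      Submodule.span K {(twoOps K).signDual.associator (dualStar K)} ∧
    Module.finrank K
      ↥(nsDualArityThree K ⊓ (twoOps K).orthogonal (sDiAssNsRel K)) = 1 ∧
    -- the same for the symmetric operad
    (twoOps K).orthogonal ((twoOps K).symSpan (sDiAssRelations K)) =
      (twoOps K).signDual.symSpan {(twoOps K).signDual.associator (dualStar K)} := by
  refine ⟨⟨QuadraticData.operadIso (sDiAss K).koszulDual (AssAdm K) (dualOpsEquiv K)
      dualOpsEquiv_swap map_koszulDual_rel, ?_, ?_⟩, finrank_nsArityThree, sDiAssNsRel_le,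
    finrank_sDiAssNsRel, sDiAssNsRel_eq_span, nsDualArityThree_inf_orthogonal, ?_,
    orthogonal_symSpan_sDiAssRelations⟩
  · exact (QuadraticData.operadIso_generator _ _ _ _ _ _).trans
      (congrArg (AssAdm K).generator dualOpsEquiv_dualOp₁)
  · exact (QuadraticData.operadIso_generator _ _ _ _ _ _).trans
      (congrArg (AssAdm K).generator dualOpsEquiv_dualOp₂)
  · rw [nsDualArityThree_inf_orthogonal]
    exact finrank_span_singleton associator_dualStar_ne_zero
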